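/- Let $G$ be a (finite-dimensional, real, $C^\infty$) Lie group, $H\subset G$ a closed subgroup, $\mathfrak g$ and $\mathfrak h$ their Lie algebras, and let $G/H$ carry the smooth structure for which the projection $\pi\colon G\to G/H$ is a smooth submersion. Put $o=\pi(e)$ and $\tau_a(gH)=agH$, and let $L_a$ be the left translation by $a$ on $G$. Assume that $G/H$ is reductive: $\mathfrak g=\mathfrak h\oplus\mathfrak m$ for a subspace $\mathfrak m$ with $\mathrm{Ad}(H)\mathfrak m\subset\mathfrak m$. Then $T_gG=(L_g)_*\mathfrak h\oplus(L_g)_*\mathfrak m$ for every $g\in G$; let $\mathbf h$ denote the projections $T_gG\to(L_g)_*\mathfrak m$ along $(L_g)_*\mathfrak h$ (so that on $\mathfrak g=T_eG$ it is the projection onto $\mathfrak m$ along $\mathfrak h$). For a vector field $X$ on $G/H$ let $\mathcal HX$ be its horizontal lift, the vector field on $G$ with $(\mathcal HX)(g)\in(L_g)_*\mathfrak m$ and $\pi_*\big((\mathcal HX)(g)\big)=X(\pi(g))$ for all $g\in G$. Let $\nabla^{G/H}$ be a $G$-invariant affine connection on $G/H$ and let $\beta\colon\mathfrak m\times\mathfrak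 m\to\mathfrak m$ be the bilinear map associated with it, that is, $$\big(\nabla^{G/H}_{A_*}B_*\big)_o=\beta(A,B)\qquad(A,B\in\mathfrak m),$$ where $\mathfrak m$ is identified with $T_o(G/H)$ by $\pi_*$ and, for $B\in\mathfrak m$, $B_*$ is the vector field $B_*(\pi(\exp u))=(\tau_{\exp u})_*\pi_*B$, $u\in U$, on the neighbourhood $\pi(\exp U)$ of $o$; here $U$ is a neighbourhood of $0$ in $\mathfrak m$ on which $u\mapsto\pi(\exp u)$ is a diffeomorphism onto an open set. Let $\alpha\colon\mathfrak g\times\mathfrak g\to\mathfrak g$ be any bilinear map with $\mathbf h\,\alpha(A,B)=\beta(A,B)$ for all $A,B\in\mathfrak m$, and let $\nabla^G$ be the left-invariant affine connection on $G$ with $(\nabla^G_{\tilde A}\tilde B)(e)=\alpha(A,B)$ for all $A,B\in\mathfrak g$, where $\tilde A(g)=(L_g)_*A$. Then for all smooth vector fields $X,Y$ on $G/H$ $$\mathbf h\big(\nabla^G_{\mathcal HX}\mathcal HY\big)=\mathcal H\big(\nabla^{G/H}_XY\big)\qquad\text{on } G.$$ In other words, $\pi\colon(G,\nabla^G)\to(G/H,\nabla^{G/H})$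 is an affine submersion with horizontal distribution $g\mapsto(L_g)_*\mathfrak m$: $\pi$ is a smooth submersion, the distribution is smooth and complementary to $\ker\pi_*$ at every point of $G$, and for all smooth vector fields $X,Y$ on $G/H$ the component of $\nabla^G_{\mathcal HX}\mathcal HY$ in this distribution along $\ker\pi_*$ is $\mathcal H(\nabla^{G/H}_XY)$. -/

import Mathlib

open scoped Manifold ContDiff Topology

noncomputable section

/-! ### Connections and submersions between manifolds -/

section General

variable {E : Type*} [NormedAddCommGroup E] [NormedSpace ℝ E]
  {M : Type*} [TopologicalSpace M] [ChartedSpace E M] [IsManifold 𝓘(ℝ, E) ∞ M]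
  {F : Type*} [NormedAddCommGroup F] [NormedSpace ℝ F]
  {N : Type*} [TopologicalSpace N] [ChartedSpace F N] [IsManifold 𝓘(ℝ, F) ∞ N]

/-- Vector fields on `M`, without any regularity. -/
abbrev VecField (E : Type*) [NormedAddCommGroup E] [NormedSpace ℝ E]
    (M : Type*) [TopologicalSpace M] [ChartedSpace E M] : Type _ :=
  (x : M) → TangentSpace 𝓘(ℝ, E) x

/-- The vector field `X` is smooth. -/
def VecField.Smooth (X : VecField E M) : Prop :=
  ContMDiff 𝓘(ℝ, E) 𝓘(ℝ, E).tangent ∞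
    (fun x ↦ (⟨x, X x⟩ : TangentBundle 𝓘(ℝ, E) M))

/-- The vector field `X` is differentiable at the point `x`. -/
def VecField.DiffAt (X : VecField E M) (x : M) : Prop :=
  MDifferentiableAt 𝓘(ℝ, E) 𝓘(ℝ, E).tangent
    (fun y ↦ (⟨y, X y⟩ : TangentBundle 𝓘(ℝ, E) M)) x

/-- Affine connections on `M`: covariant derivatives on the tangent bundle of `M`. -/
abbrev AffineConnection (E : Type*) [NormedAddCommGroup E] [NormedSpace ℝ E]
    (M : Type*) [TopologicalSpace M] [ChartedSpace E M] [IsManifold 𝓘(ℝ, E) ∞ M] : Type _ :=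
  CovariantDerivative 𝓘(ℝ, E) E (TangentSpace 𝓘(ℝ, E) : M → Type _)

/-- The vector field `∇_X Y`. (In Mathlib, `∇ Y x v` is the derivative of `Y` at `x` in the
direction `v`.) -/
def AffineConnection.deriv (nabla : AffineConnection E M) (X Y : VecField E M) :
    VecField E M :=
  fun x ↦ nabla Y x (X x)

/-- The diffeomorphism `f` preserves the connection `∇`, i.e. `f_* (∇_v (f^* Y)) = ∇_{f_* v} Y`
for all tangent vectors `v` and all smooth vector fields `Y`, where `f^* Y = (f⁻¹)_* Y`. -/
def AffineConnection.PreservedBy (nabla : AffineConnection E M) (f : M → M) : Prop :=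
  ∀ Y : VecField E M, Y.Smooth → ∀ (x : M) (v : TangentSpace 𝓘(ℝ, E) x),
    mfderiv 𝓘(ℝ, E) 𝓘(ℝ, E) f x
        (nabla (VectorField.mpullback 𝓘(ℝ, E) 𝓘(ℝ, E) f Y) x v) =
      nabla Y (f x) (mfderiv 𝓘(ℝ, E) 𝓘(ℝ, E) f x v)

/-- The horizontal lift of the vector field `X` on `N` along `p : M → N` with respect to a
distribution `D` on `M` such that each `dp_x` restricts to an isomorphism from `D x` onto the
tangent space of `N` at `p x`: the value at `x` is the vector of `D x` that `dp_x` maps to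
`X (p x)`. -/
def horizontalLift (p : M → N) (D : (x : M) → Submodule ℝ (TangentSpace 𝓘(ℝ, E) x))
    (X : VecField F N) : VecField E M :=
  fun x ↦ (((mfderiv 𝓘(ℝ, E) 𝓘(ℝ, F) p x).comp (D x).subtypeL).inverse (X (p x)) : D x)

/-- The distribution `D` is smooth: each of its vectors is the value of a local smooth section. -/
def IsSmoothDistribution (D : (x : M) → Submodule ℝ (TangentSpace 𝓘(ℝ, E) x)) : Prop :=
  ∀ (x : M), ∀ v ∈ D x, ∃ V : VecField E M, V x = v ∧ (∀ᶠ y in 𝓝 x, V y ∈ D y) ∧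
    ContMDiffAt 𝓘(ℝ, E) 𝓘(ℝ, E).tangent ∞
      (fun y ↦ (⟨y, V y⟩ : TangentBundle 𝓘(ℝ, E) M)) x

/-- `p : M → N` is an affine submersion with horizontal distribution `D` from `(M, ∇M)` to
`(N, ∇N)`: `p` is a smooth submersion, `D` is a smooth distribution complementary to the vertical
one, and the horizontal part of `∇M_{X̃} Ỹ` is the horizontal lift of `∇N_X Y`, where `X̃`, `Ỹ`
are the horizontal lifts of the smooth vector fields `X`, `Y`. -/
structure IsAffineSubmersionWithHorizontalDistribution (p : M → N)
    (D : (x : M) → Submodule ℝ (TangentSpace 𝓘(ℝ, E) x))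
    (nablaM : AffineConnection E M) (nablaN : AffineConnection F N) : Prop where
  submersion : Manifold.IsSubmersion 𝓘(ℝ, E) 𝓘(ℝ, F) ∞ p
  smooth : IsSmoothDistribution D
  isCompl : ∀ x : M, IsCompl (D x) (mfderiv 𝓘(ℝ, E) 𝓘(ℝ, F) p x).ker
  horizontal_deriv : ∀ X Y : VecField F N, X.Smooth → Y.Smooth → ∀ x : M,
    (D x).projection (mfderiv 𝓘(ℝ, E) 𝓘(ℝ, F) p x).ker (isCompl x)
        (nablaM.deriv (horizontalLift p D X) (horizontalLift p D Y) x) =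
      horizontalLift p D (nablaN.deriv X Y) x

end General

/-! ### Lie groups -/

section Group

variable {E : Type*} [NormedAddCommGroup E] [NormedSpace ℝ E]
  {G : Type*} [TopologicalSpace G] [ChartedSpace E G] [Group G]

/-- The differential `(L_g)_*` at `1` of the left translation by `g`. -/
def leftTranslate (g : G) : GroupLieAlgebra 𝓘(ℝ, E) G →L[ℝ] TangentSpace 𝓘(ℝ, E) g :=
  (mfderiv 𝓘(ℝ, E) 𝓘(ℝ, E) (fun x : G ↦ g * x) 1 :)

/-- The adjoint action `Ad g` on the Lie algebra. -/
def lieAd (g : G) : GroupLieAlgebra 𝓘(ℝ, E) G →L[ℝ] GroupLieAlgebra 𝓘(ℝ, E) G :=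
  (mfderiv 𝓘(ℝ, E) 𝓘(ℝ, E) (fun x : G ↦ g * x * g⁻¹) 1 :)

open Classical in
/-- The exponential map: `exp A = γ 1`, where `γ` is the integral curve of the left-invariant
vector field of `A` with `γ 0 = 1`. (Such a `γ` exists in every Lie group.) -/
def lieExp (A : GroupLieAlgebra 𝓘(ℝ, E) G) : G :=
  if h : ∃ γ : ℝ → G, γ 0 = 1 ∧ IsMIntegralCurve (I := 𝓘(ℝ, E)) γ (mulInvariantVectorField A)
  then h.choose 1 else 1

/-- The left-invariant distribution `g ↦ (L_g)_* m` on `G`. -/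
def leftInvariantDistribution (m : Submodule ℝ (GroupLieAlgebra 𝓘(ℝ, E) G)) (g : G) :
    Submodule ℝ (TangentSpace 𝓘(ℝ, E) g) :=
  m.map (leftTranslate g).toLinearMap

/-- The projection of the tangent space of `G` at `g` onto `(L_g)_* m` along `(L_g)_* h`. -/
def horizontalPart {h m : Submodule ℝ (GroupLieAlgebra 𝓘(ℝ, E) G)} (hm : IsCompl h m) (g : G)
    (v : TangentSpace 𝓘(ℝ, E) g) : TangentSpace 𝓘(ℝ, E) g :=
  leftTranslate g (m.projection h hm.symm ((leftTranslate g).inverse v))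

/-- The left-invariant affine connection `∇` on `G` is the one defined by the bilinear map `α`:
`∇` is invariant under left translations and `(∇_{Ã} B̃)(1) = α(A, B)` for the left-invariant
vector fields `Ã`, `B̃`. -/
structure IsLeftInvariantConnectionOf [IsManifold 𝓘(ℝ, E) ∞ G]
    (alpha : GroupLieAlgebra 𝓘(ℝ, E) G →ₗ[ℝ]
      GroupLieAlgebra 𝓘(ℝ, E) G →ₗ[ℝ] GroupLieAlgebra 𝓘(ℝ, E) G)
    (nabla : AffineConnection E G) : Prop where
  invariant : ∀ a : G, nabla.PreservedBy (fun x : G ↦ a * x)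
  deriv_one : ∀ A B : GroupLieAlgebra 𝓘(ℝ, E) G,
    nabla.deriv (mulInvariantVectorField A) (mulInvariantVectorField B) 1 = alpha A B

end Group

section LieSubalgebra

/-- The velocity at time `0` of a curve `c` in `G`, a vector of the tangent space at `c 0` (as a
type, this tangent space is the model space `E`). -/
def initialVelocity (E : Type*) [NormedAddCommGroup E] [NormedSpace ℝ E]
    {G : Type*} [TopologicalSpace G] [ChartedSpace E G] (c : ℝ → G) : E :=
  mfderiv 𝓘(ℝ, ℝ) 𝓘(ℝ, E) c 0 (1 : ℝ)

theorem initialVelocity_mul {E : Type*} [NormedAddCommGroup E] [NormedSpace ℝ E]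
    {G : Type*} [TopologicalSpace G] [ChartedSpace E G] [Group G] [LieGroup 𝓘(ℝ, E) ∞ G]
    {c d : ℝ → G}
    (hc : MDifferentiableAt 𝓘(ℝ, ℝ) 𝓘(ℝ, E) c 0) (hd : MDifferentiableAt 𝓘(ℝ, ℝ) 𝓘(ℝ, E) d 0)
    (hc0 : c 0 = 1) (hd0 : d 0 = 1) :
    initialVelocity E (fun t ↦ c t * d t) = initialVelocity E c + initialVelocity E d := by
  have hm : MDifferentiableAt (𝓘(ℝ, E).prod 𝓘(ℝ, E)) 𝓘(ℝ, E)
      (fun p : G × G ↦ p.1 * p.2) (c 0, d 0) :=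
    (contMDiff_mul 𝓘(ℝ, E) ∞).mdifferentiable (by simp) _
  have hcomp := (hm.hasMFDerivAt.comp (0 : ℝ) (hc.hasMFDerivAt.prodMk hd.hasMFDerivAt)).mfderiv
  have e1 : (fun z : G ↦ z * d 0) = id := by funext z; simp [hd0]
  have e2 : (fun z : G ↦ c 0 * z) = id := by funext z; simp [hc0]
  have hid : ∀ f : G → G, f = id → ∀ (x : G) (v : E),
      (mfderiv 𝓘(ℝ, E) 𝓘(ℝ, E) f x : E →L[ℝ] E) v = v := by
    rintro f rfl x v
    exact DFunLike.congr_fun (mfderiv_id (I := 𝓘(ℝ, E)) (x := x)) v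
  exact (DFunLike.congr_fun hcomp (1 : ℝ)).trans ((mfderiv_prod_eq_add_apply hm).trans
    (congr_arg₂ (fun x y : E ↦ x + y) (hid _ e1 _ _) (hid _ e2 _ _)))

/-- The Lie algebra of a closed subgroup `H` of `G`, as a subspace of the Lie algebra of `G`: the
space of velocities at `1` of the curves in `H` that are smooth as curves in `G`. -/
def closedSubgroupLieAlgebra (E : Type*) [NormedAddCommGroup E] [NormedSpace ℝ E]
    {G : Type*} [TopologicalSpace G] [ChartedSpace E G] [Group G] [LieGroup 𝓘(ℝ, E) ∞ G]
    (H : Subgroup G) : Submodule ℝ (GroupLieAlgebra 𝓘(ℝ, E) G) where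
  carrier := {A | ∃ c : ℝ → G, ContMDiffAt 𝓘(ℝ, ℝ) 𝓘(ℝ, E) ∞ c 0 ∧ c 0 = 1 ∧
    (∀ᶠ t in 𝓝 0, c t ∈ H) ∧ initialVelocity E c = A}
  zero_mem' := by
    refine ⟨fun _ ↦ 1, contMDiffAt_const, rfl, Filter.Eventually.of_forall fun _ ↦ H.one_mem, ?_⟩
    exact DFunLike.congr_fun (mfderiv_const (c := (1 : G))) (1 : ℝ)
  add_mem' := by
    rintro A B ⟨c, hc, hc0, hcH, hcA⟩ ⟨d, hd, hd0, hdH, hdB⟩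
    refine ⟨fun t ↦ c t * d t, hc.mul hd, by simp [hc0, hd0], ?_, ?_⟩
    · filter_upwards [hcH, hdH] with t h1 h2 using H.mul_mem h1 h2
    · exact (initialVelocity_mul (hc.mdifferentiableAt (by simp))
        (hd.mdifferentiableAt (by simp)) hc0 hd0).trans (congr_arg₂ (fun x y : E ↦ x + y) hcA hdB)
  smul_mem' := by
    rintro a A ⟨c, hc, hc0, hcH, hcA⟩
    have h0 : a * (0 : ℝ) = 0 := mul_zero a
    have hl : HasMFDerivAt 𝓘(ℝ, ℝ) 𝓘(ℝ, ℝ) (fun t : ℝ ↦ a * t) 0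
        (a • ContinuousLinearMap.id ℝ ℝ) :=
      ((hasFDerivAt_id (0 : ℝ)).const_mul a).hasMFDerivAt
    have hcm : ContMDiffAt 𝓘(ℝ, ℝ) 𝓘(ℝ, E) ∞ c (a * 0) := by rwa [h0]
    have hlin : ContMDiffAt 𝓘(ℝ, ℝ) 𝓘(ℝ, ℝ) ∞ (fun t : ℝ ↦ a * t) 0 :=
      (contDiff_const.mul contDiff_id).contMDiff.contMDiffAt
    refine ⟨fun t ↦ c (a * t), hcm.comp 0 hlin, by simp [hc0], ?_, ?_⟩
    · have ht : Filter.Tendsto (fun t : ℝ ↦ a * t) (𝓝 0) (𝓝 0) := by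
        simpa using (continuous_const_mul a).tendsto (0 : ℝ)
      exact ht.eventually hcH
    · have hcd : HasMFDerivAt 𝓘(ℝ, ℝ) 𝓘(ℝ, E) c (a * 0)
          (mfderiv 𝓘(ℝ, ℝ) 𝓘(ℝ, E) c (a * 0)) :=
        (hcm.mdifferentiableAt (by simp)).hasMFDerivAt
      have h1 := (hcd.comp (0 : ℝ) hl).mfderiv
      have h2 : (initialVelocity E (fun t ↦ c (a * t)) : E) =
          (mfderiv 𝓘(ℝ, ℝ) 𝓘(ℝ, E) c (a * 0) : ℝ →L[ℝ] E) (a • (1 : ℝ)) :=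
        DFunLike.congr_fun h1 (1 : ℝ)
      have h3 : ((mfderiv 𝓘(ℝ, ℝ) 𝓘(ℝ, E) c (a * 0) : ℝ →L[ℝ] E) (1 : ℝ) : E) = A := by
        rw [h0]
        exact hcA
      exact h2.trans ((ContinuousLinearMap.map_smul
        (mfderiv 𝓘(ℝ, ℝ) 𝓘(ℝ, E) c (a * 0) : ℝ →L[ℝ] E) a (1 : ℝ)).trans
          (congr_arg (fun x : E ↦ a • x) h3))

end LieSubalgebra

/-! ### Homogeneous spaces -/

section Homogeneous

variable {E : Type*} [NormedAddCommGroup E] [NormedSpace ℝ E]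
  {G : Type*} [TopologicalSpace G] [ChartedSpace E G] [Group G]
  {F : Type*} [NormedAddCommGroup F] [NormedSpace ℝ F] {H : Subgroup G}
  [ChartedSpace F (G ⧸ H)]

/-- The projection `π : G → G/H`. -/
abbrev cosetProj (H : Subgroup G) : G → G ⧸ H := fun g ↦ (g : G ⧸ H)

/-- The differential at `1` of the projection `π : G → G/H`. -/
def cosetProjDeriv (E F : Type*) [NormedAddCommGroup E] [NormedSpace ℝ E]
    [NormedAddCommGroup F] [NormedSpace ℝ F]
    {G : Type*} [TopologicalSpace G] [ChartedSpace E G] [Group G]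
    (H : Subgroup G) [ChartedSpace F (G ⧸ H)] :
    GroupLieAlgebra 𝓘(ℝ, E) G →L[ℝ] TangentSpace 𝓘(ℝ, F) (cosetProj H 1) :=
  mfderiv 𝓘(ℝ, E) 𝓘(ℝ, F) (cosetProj H) 1

/-- The differential at the origin of the translation `τ_g : G/H → G/H`. -/
def cosetTranslate (F : Type*) [NormedAddCommGroup F] [NormedSpace ℝ F]
    (H : Subgroup G) [ChartedSpace F (G ⧸ H)] (g : G) :
    TangentSpace 𝓘(ℝ, F) (cosetProj H 1) →L[ℝ] TangentSpace 𝓘(ℝ, F) (cosetProj H g) :=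
  (mfderiv 𝓘(ℝ, F) 𝓘(ℝ, F) (fun q : G ⧸ H ↦ g • q) (cosetProj H 1) :)

/-- The reductive decomposition `𝔤 = 𝔥 ⊕ m` with `Ad(H) m ⊆ m`. -/
structure IsReductiveComplement [LieGroup 𝓘(ℝ, E) ∞ G] (H : Subgroup G)
    (m : Submodule ℝ (GroupLieAlgebra 𝓘(ℝ, E) G)) : Prop where
  isCompl : IsCompl (closedSubgroupLieAlgebra E H) m
  ad_mem : ∀ a ∈ H, ∀ A ∈ m, lieAd a A ∈ m

/-- The vector field `Z` on `G/H` coincides near the origin with the local field `B_*` defined on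
the neighbourhood `{π (exp u) | u ∈ U}` of the origin, for a small neighbourhood `U` of `0` in `m`,
by `B_*(π (exp u)) = (τ_{exp u})_* (π_* B)`. -/
def IsLocallyStar (m : Submodule ℝ (GroupLieAlgebra 𝓘(ℝ, E) G)) (B : m)
    (Z : VecField F (G ⧸ H)) : Prop :=
  ∀ᶠ u : m in 𝓝 0, Z (cosetProj H (lieExp (u : GroupLieAlgebra 𝓘(ℝ, E) G))) =
    cosetTranslate F H (lieExp (u : GroupLieAlgebra 𝓘(ℝ, E) G)) (cosetProjDeriv E F H B)

/-- `β` is the bilinear map on `m` associated with the connection `∇` on `G/H`, namely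
`(∇_{A_*} B_*)(o) = β(A, B)`, where `m` is identified with the tangent space at the origin `o` by
`π_*`. Since `∇` is local, `B_*` may be replaced by any vector field on `G/H` that is
differentiable at `o` and coincides with `B_*` near `o`. -/
def IsBilinearFormOf [IsManifold 𝓘(ℝ, F) ∞ (G ⧸ H)]
    (m : Submodule ℝ (GroupLieAlgebra 𝓘(ℝ, E) G)) (beta : m →ₗ[ℝ] m →ₗ[ℝ] m)
    (nabla : AffineConnection F (G ⧸ H)) : Prop :=
  ∀ (A B : m) (Z : VecField F (G ⧸ H)), Z.DiffAt (cosetProj H 1) → IsLocallyStar m B Z →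
    nabla Z (cosetProj H 1) (cosetProjDeriv E F H A) = cosetProjDeriv E F H (beta A B)

end Homogeneous

end

/-! Both sides are computed in frames obtained by translating a basis of the tangent space at the
origin `o`, and the two results have the same coordinates.

A smooth field `Y` on `G/H` has the form `Y (π g) = (τ_g)_* (b g)` for a function `b` on `G` with
values in `T_o(G/H)`, which is smooth (`exists_smooth_coefficient`). Let `ι` be the inverse of `π_*`
restricted to `m` and `v i` a basis of `T_o(G/H)`. The horizontal lift of `Y` is then the
combination of the left-invariant fields of `ι (v i)` with the coordinates of `b` as coefficients.
If `X (π g) = (τ_g)_* a`, the Leibniz rule and left invariance give `∇^G` at `g` as `(L_g)_*` of the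
sum of `bⁱ(g) α(ι a, ι (v i)) + dbⁱ((L_g)_* ι a) ι (v i)`, and the projection to `m` turns `α` into
`β`.

On `G/H`, invariance moves the computation to `o`, with `Y` replaced by its pullback under `τ_g`.
For any section `σ` of `π` this pullback is `q ↦ (τ_{σ q})_* b(g σ(q))` (`mpullback_smul_eq`). For
the exponential section, `σ (π (exp u)) = exp u` for small `u` in `m`, the translated basis vectors
are the local fields `B_*`, whose derivatives at `o` are given by `β`. As `dσ = ι` at `o`, the
coefficients have derivative `dbⁱ((L_g)_* ι a)`, and the same sum appears.

The analytic input is the exponential section (`exists_exponential_section`). It only has to be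
differentiable at `o`, so strict differentiability of `exp` at `0` suffices. This follows from a
parametric estimate for ordinary differential equations (`exists_solution_hasStrictFDerivAt`) and
the inverse function theorem. -/

noncomputable section

set_option linter.unusedSectionVars false

/-! ### Local sections, vertical curves and descent of smoothness for submersions. -/

section Submersion

open Manifold Filter

variable {E : Type*} [NormedAddCommGroup E] [NormedSpace ℝ E]
  {M : Type*} [TopologicalSpace M] [ChartedSpace E M]
  {F : Type*} [NormedAddCommGroup F] [NormedSpace ℝ F]
  {N : Type*} [TopologicalSpace N] [ChartedSpace F N]

/-- A submersion is, near each point, the composition of a diffeomorphism with a linear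
projection. -/
theorem Manifold.IsSubmersion.exists_localForm {p : M → N}
    (hp : IsSubmersion 𝓘(ℝ, E) 𝓘(ℝ, F) ∞ p) (x : M) :
    ∃ (e : OpenPartialHomeomorph M E) (c : OpenPartialHomeomorph N F) (r : E →L[ℝ] F)
      (s : F →L[ℝ] E), x ∈ e.source ∧ p x ∈ c.source ∧
      ContMDiffOn 𝓘(ℝ, E) 𝓘(ℝ, E) ∞ e e.source ∧
      ContMDiffOn 𝓘(ℝ, E) 𝓘(ℝ, E) ∞ e.symm e.target ∧
      ContMDiffOn 𝓘(ℝ, F) 𝓘(ℝ, F) ∞ c c.source ∧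
      (∀ y ∈ e.target, p (e.symm y) ∈ c.source ∧ c (p (e.symm y)) = r y) ∧ ∀ z, r (s z) = z := by
  have h := hp.isSubmersionAt x
  refine ⟨h.domChart, h.codChart, (ContinuousLinearMap.fst ℝ F _).comp h.equiv.toContinuousLinearMap,
    h.equiv.symm.toContinuousLinearMap.comp (ContinuousLinearMap.inl ℝ F _), h.mem_domChart_source,
    h.mem_codChart_source, contMDiffOn_of_mem_maximalAtlas h.domChart_mem_maximalAtlas,
    contMDiffOn_symm_of_mem_maximalAtlas h.domChart_mem_maximalAtlas,
    contMDiffOn_of_mem_maximalAtlas h.codChart_mem_maximalAtlas, fun y hy ↦ ⟨?_, ?_⟩, ?_⟩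
  · exact h.source_subset_preimage_source (h.domChart.map_target hy)
  · have := h.writtenInCharts (show y ∈ (h.domChart.extend 𝓘(ℝ, E)).target by simpa using hy)
    simpa using this
  · intro z; simp

/-- In the local form the submersion is a linear map `r` with right inverse `s`, so an affine copy
of `s` through the coordinates of `x` is a section. -/
theorem Manifold.IsSubmersion.exists_section {p : M → N}
    (hp : IsSubmersion 𝓘(ℝ, E) 𝓘(ℝ, F) ∞ p) (x : M) :
    ∃ s : N → M, s (p x) = x ∧ ContMDiffAt 𝓘(ℝ, F) 𝓘(ℝ, E) ∞ s (p x) ∧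
      ∀ᶠ q in 𝓝 (p x), p (s q) = q := by
  obtain ⟨e, c, r, s, hx, hpx, he, he', hc, hr, hrs⟩ := hp.exists_localForm x
  have h0 : c (p x) = r (e x) := by
    have := (hr (e x) (e.map_source hx)).2
    rwa [e.left_inv hx] at this
  let φ : N → E := fun q ↦ e x + s (c q - c (p x))
  have hφ0 : φ (p x) = e x := by simp [φ]
  have hφ : ContMDiffAt 𝓘(ℝ, F) 𝓘(ℝ, E) ∞ φ (p x) := by
    have h1 : ContMDiffAt 𝓘(ℝ, F) 𝓘(ℝ, F) ∞ c (p x) :=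
      hc.contMDiffAt (c.open_source.mem_nhds hpx)
    have h2 : ContDiff ℝ ∞ (fun z : F ↦ e x + s (z - c (p x))) := by fun_prop
    exact h2.contMDiff.contMDiffAt.comp (p x) h1
  have ht : ∀ᶠ q in 𝓝 (p x), φ q ∈ e.target :=
    hφ.continuousAt.eventually_mem (by rw [hφ0]; exact e.open_target.mem_nhds (e.map_source hx))
  refine ⟨fun q ↦ e.symm (φ q), by simp [hφ0, e.left_inv hx], ?_, ?_⟩
  · have h1 : ContMDiffAt 𝓘(ℝ, E) 𝓘(ℝ, E) ∞ e.symm (φ (p x)) := by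
      rw [hφ0]; exact he'.contMDiffAt (e.open_target.mem_nhds (e.map_source hx))
    exact h1.comp (p x) hφ
  · filter_upwards [ht, c.open_source.mem_nhds hpx] with q hq hqc
    obtain ⟨h1, h2⟩ := hr _ hq
    refine c.injOn h1 hqc ?_
    rw [h2]
    simp [φ, hrs, h0]

/-- A map out of the target of a surjective submersion is smooth if its composition with the
submersion is. -/
theorem Manifold.IsSubmersion.contMDiff_of_comp {E' : Type*} [NormedAddCommGroup E']
    [NormedSpace ℝ E'] {M' : Type*} [TopologicalSpace M'] [ChartedSpace E' M'] {p : M → N}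
    (hp : IsSubmersion 𝓘(ℝ, E) 𝓘(ℝ, F) ∞ p) (hs : Function.Surjective p) {f : N → M'}
    (hf : ContMDiff 𝓘(ℝ, E) 𝓘(ℝ, E') ∞ (f ∘ p)) : ContMDiff 𝓘(ℝ, F) 𝓘(ℝ, E') ∞ f := by
  intro q
  obtain ⟨x, rfl⟩ := hs q
  obtain ⟨s, hsx, hs, hps⟩ := hp.exists_section x
  have h1 : ContMDiffAt 𝓘(ℝ, F) 𝓘(ℝ, E') ∞ ((f ∘ p) ∘ s) (p x) := hf.contMDiffAt.comp _ hs
  refine h1.congr_of_eventuallyEq ?_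
  filter_upwards [hps] with q hq
  simp [hq]

theorem Manifold.IsSubmersion.mfderiv_surjective [IsManifold 𝓘(ℝ, E) ∞ M]
    [IsManifold 𝓘(ℝ, F) ∞ N] {p : M → N}
    (hp : IsSubmersion 𝓘(ℝ, E) 𝓘(ℝ, F) ∞ p) (x : M) :
    Function.Surjective (mfderiv 𝓘(ℝ, E) 𝓘(ℝ, F) p x) := by
  obtain ⟨s, hsx, hs, hps⟩ := hp.exists_section x
  have h1 : HasMFDerivAt 𝓘(ℝ, F) 𝓘(ℝ, E) s (p x) (mfderiv 𝓘(ℝ, F) 𝓘(ℝ, E) s (p x)) :=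
    (hs.mdifferentiableAt (by simp)).hasMFDerivAt
  have h2 : HasMFDerivAt 𝓘(ℝ, E) 𝓘(ℝ, F) p (s (p x)) (mfderiv 𝓘(ℝ, E) 𝓘(ℝ, F) p (s (p x))) :=
    (hp.contMDiff.mdifferentiable (by simp) _).hasMFDerivAt
  have h3 := (h2.comp (p x) h1).congr_of_eventuallyEq (f₁ := id) (by
    filter_upwards [hps] with q hq using hq.symm)
  have h4 := hasMFDerivAt_unique h3 (hasMFDerivAt_id (p x))
  intro w
  have h5 := DFunLike.congr_fun h4 w
  rw [hsx] at h5
  exact ⟨_, h5⟩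

/-- Each vertical vector of a submersion is the velocity of a smooth curve in a fibre. -/
theorem Manifold.IsSubmersion.exists_curve [IsManifold 𝓘(ℝ, E) ∞ M]
    [IsManifold 𝓘(ℝ, F) ∞ N] {p : M → N}
    (hp : IsSubmersion 𝓘(ℝ, E) 𝓘(ℝ, F) ∞ p) (x : M) (v : TangentSpace 𝓘(ℝ, E) x)
    (hv : mfderiv 𝓘(ℝ, E) 𝓘(ℝ, F) p x v = 0) :
    ∃ c : ℝ → M, ContMDiffAt 𝓘(ℝ, ℝ) 𝓘(ℝ, E) ∞ c 0 ∧ c 0 = x ∧ (∀ᶠ t in 𝓝 0, p (c t) = p x) ∧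
      initialVelocity E c = v := by
  obtain ⟨e, c, r, s, hx, hpx, he, he', hc, hr, hrs⟩ := hp.exists_localForm x
  have hex := e.map_source hx
  have de : HasMFDerivAt 𝓘(ℝ, E) 𝓘(ℝ, E) e x (mfderiv 𝓘(ℝ, E) 𝓘(ℝ, E) e x) :=
    ((he.contMDiffAt (e.open_source.mem_nhds hx)).mdifferentiableAt (by simp)).hasMFDerivAt
  have se' : ContMDiffAt 𝓘(ℝ, E) 𝓘(ℝ, E) ∞ e.symm (e x) :=
    he'.contMDiffAt (e.open_target.mem_nhds hex)
  have de' : HasMFDerivAt 𝓘(ℝ, E) 𝓘(ℝ, E) e.symm (e x) (mfderiv 𝓘(ℝ, E) 𝓘(ℝ, E) e.symm (e x)) :=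
    (se'.mdifferentiableAt (by simp)).hasMFDerivAt
  have dp : HasMFDerivAt 𝓘(ℝ, E) 𝓘(ℝ, F) p x (mfderiv 𝓘(ℝ, E) 𝓘(ℝ, F) p x) :=
    (hp.contMDiff.mdifferentiable (by simp) _).hasMFDerivAt
  have dc : HasMFDerivAt 𝓘(ℝ, F) 𝓘(ℝ, F) c (p x) (mfderiv 𝓘(ℝ, F) 𝓘(ℝ, F) c (p x)) :=
    ((hc.contMDiffAt (c.open_source.mem_nhds hpx)).mdifferentiableAt (by simp)).hasMFDerivAt
  have dr : HasMFDerivAt 𝓘(ℝ, E) 𝓘(ℝ, F) r (e x) r := r.hasFDerivAt.hasMFDerivAt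
  -- The curve is the straight line with direction `w` in the chart `e`; it stays in the fibre
  -- because `r w = 0`.
  set w : E := mfderiv 𝓘(ℝ, E) 𝓘(ℝ, E) e x v with hw
  have hrw : r w = 0 := by
    have h1 := (dr.comp x de).congr_of_eventuallyEq (f₁ := c ∘ p) (by
      filter_upwards [e.open_source.mem_nhds hx] with y hy
      have := (hr _ (e.map_source hy)).2
      rwa [e.left_inv hy] at this)
    have h2 := hasMFDerivAt_unique h1 (dc.comp x dp)
    refine (DFunLike.congr_fun h2 v).trans ?_
    refine (congrArg (mfderiv 𝓘(ℝ, F) 𝓘(ℝ, F) c (p x)) hv).trans ?_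
    exact ContinuousLinearMap.map_zero _
  have hew : (mfderiv 𝓘(ℝ, E) 𝓘(ℝ, E) e.symm (e x) : E →L[ℝ] E) w = v := by
    have h1 := (de'.comp x de).congr_of_eventuallyEq (f₁ := id) (by
      filter_upwards [e.open_source.mem_nhds hx] with y hy using (e.left_inv hy).symm)
    exact DFunLike.congr_fun (hasMFDerivAt_unique h1 (hasMFDerivAt_id x)) v
  let l : ℝ → E := fun t ↦ e x + t • w
  have hl0 : l 0 = e x := by simp [l]
  have hl : ContDiff ℝ ∞ l := by fun_prop
  have hld : HasMFDerivAt 𝓘(ℝ, ℝ) 𝓘(ℝ, E) l 0 ((1 : ℝ →L[ℝ] ℝ).smulRight w) := by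
    have : HasDerivAt l ((1 : ℝ) • w) 0 := ((hasDerivAt_id (0 : ℝ)).smul_const w).const_add _
    rw [one_smul] at this
    exact this.hasFDerivAt.hasMFDerivAt
  refine ⟨fun t ↦ e.symm (l t), ?_, by simp [hl0, e.left_inv hx], ?_, ?_⟩
  · exact ContMDiffAt.comp (0 : ℝ) (by rwa [hl0]) hl.contMDiff.contMDiffAt
  · have ht : ∀ᶠ t in 𝓝 0, l t ∈ e.target :=
      hl.continuous.continuousAt.eventually_mem (by rw [hl0]; exact e.open_target.mem_nhds hex)
    filter_upwards [ht] with t ht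
    obtain ⟨h1, h2⟩ := hr _ ht
    refine c.injOn h1 hpx ?_
    have h3 := (hr _ hex).2
    rw [e.left_inv hx] at h3
    rw [h2, h3]
    simp [l, hrw]
  · rw [← hl0] at de'
    have h1 := (de'.comp (0 : ℝ) hld).mfderiv
    refine (DFunLike.congr_fun h1 (1 : ℝ)).trans ?_
    rw [hl0]
    refine Eq.trans ?_ hew
    change (mfderiv 𝓘(ℝ, E) 𝓘(ℝ, E) e.symm (e x) : E →L[ℝ] E) ((1 : ℝ) • w) = _
    rw [one_smul]

end Submersion

/-! ### Dependence of solutions of an ordinary differential equation on a parameter. -/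

section ParametricODE

open Metric Set

/-- The solutions of `x' = W (x, u)` with initial value `x₀`, for a field `W` that vanishes for
`u = 0` and is equal to `u` at `x₀`, exist for a uniform time `ε` and depend strictly
differentiably on the parameter `u` at `u = 0`. -/
theorem exists_solution_hasStrictFDerivAt {E : Type*} [NormedAddCommGroup E] [NormedSpace ℝ E]
    [CompleteSpace E] {W : E × E → E} {x₀ : E} (hW : ContDiffAt ℝ 1 W (x₀, 0))
    (hW0 : ∀ x, W (x, 0) = 0) (hW1 : ∀ u, W (x₀, u) = u) :
    ∃ ε > (0 : ℝ), ∃ r > (0 : ℝ), ∃ α : E → ℝ → E, ∃ C : ℝ,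
      (∀ u ∈ closedBall (0 : E) r, α u 0 = x₀ ∧ ∀ t ∈ Icc (-ε) ε,
        HasDerivWithinAt (α u) (W (α u t, u)) (Icc (-ε) ε) t ∧ ‖α u t - x₀‖ ≤ C * ‖u‖) ∧
      ∀ t ∈ Icc (-ε) ε,
        HasStrictFDerivAt (fun u ↦ α u t) (t • ContinuousLinearMap.id ℝ E) 0 := by
  -- The parameter becomes a second component with zero derivative, so that dependence on it is
  -- dependence on the initial value, which Picard–Lindelöf controls.
  have hV : ContDiffAt ℝ 1 (fun p : E × E ↦ (W p, (0 : E))) (x₀, 0) := hW.prodMk contDiffAt_const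
  obtain ⟨ε, hε, a, r, L, K, hr, hpl⟩ := IsPicardLindelof.of_contDiffAt_one hV
  obtain ⟨β, hβ, L', hL'⟩ :=
    (hpl 0).exists_forall_mem_closedBall_eq_hasDerivWithinAt_lipschitzOnWith
  simp only [zero_sub, zero_add] at hβ hL'
  set I : Set ℝ := Icc (-ε) ε with hI
  have hI0 : (0 : ℝ) ∈ I := ⟨by linarith, hε.le⟩
  have hIc : Convex ℝ I := convex_Icc _ _
  have hmem : ∀ u ∈ closedBall (0 : E) r, ((x₀, u) : E × E) ∈ closedBall ((x₀, 0) : E × E) r := by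
    intro u hu
    rw [mem_closedBall, dist_zero_right] at hu
    simpa [Prod.dist_eq] using hu
  have hsnd : ∀ u ∈ closedBall (0 : E) r, ∀ t ∈ I, (β (x₀, u) t).2 = u := by
    intro u hu t ht
    obtain ⟨h1, h2⟩ := hβ _ (hmem u hu)
    have h3 : ∀ s ∈ I, HasDerivWithinAt (fun s ↦ (β (x₀, u) s).2) 0 I s :=
      fun s hs ↦ (h2 s hs).snd
    have h4 := hIc.norm_image_sub_le_of_norm_hasDerivWithin_le (C := 0) h3 (by simp) hI0 ht
    rw [zero_mul, norm_le_zero_iff, sub_eq_zero] at h4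
    rw [h4, h1]
  have hfst : ∀ u ∈ closedBall (0 : E) r, ∀ t ∈ I,
      HasDerivWithinAt (fun s ↦ (β (x₀, u) s).1) (W ((β (x₀, u) t).1, u)) I t := by
    intro u hu t ht
    have h1 := ((hβ _ (hmem u hu)).2 t ht).fst
    have h2 : (β (x₀, u) t) = ((β (x₀, u) t).1, u) := Prod.ext rfl (hsnd u hu t ht)
    rwa [h2] at h1
  have h0mem : (0 : E) ∈ closedBall (0 : E) r := mem_closedBall_self (by exact_mod_cast hr.le)
  have hconst : ∀ t ∈ I, (β (x₀, 0) t).1 = x₀ := by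
    intro t ht
    have h4 := hIc.norm_image_sub_le_of_norm_hasDerivWithin_le (C := 0) (hfst 0 h0mem)
      (by simp [hW0]) hI0 ht
    rw [zero_mul, norm_le_zero_iff, sub_eq_zero] at h4
    rw [h4, (hβ _ (hmem 0 h0mem)).1]
  have hlip : ∀ u ∈ closedBall (0 : E) r, ∀ u' ∈ closedBall (0 : E) r, ∀ t ∈ I,
      ‖(β (x₀, u) t).1 - (β (x₀, u') t).1‖ ≤ L' * ‖u - u'‖ := by
    intro u hu u' hu' t ht
    have h1 := (hL' t ht).dist_le_mul _ (hmem u hu) _ (hmem u' hu')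
    rw [dist_eq_norm, dist_eq_norm] at h1
    have h2 : ‖((x₀, u) : E × E) - (x₀, u')‖ = ‖u - u'‖ := by simp [Prod.norm_def]
    rw [h2] at h1
    exact (norm_fst_le (β (x₀, u) t - β (x₀, u') t)).trans h1
  have hbound : ∀ u ∈ closedBall (0 : E) r, ∀ t ∈ I, ‖(β (x₀, u) t).1 - x₀‖ ≤ L' * ‖u‖ := by
    intro u hu t ht
    have := hlip u hu 0 h0mem t ht
    rwa [hconst t ht, sub_zero] at this
  refine ⟨ε, hε, r, by exact_mod_cast hr, fun u t ↦ (β (x₀, u) t).1, L',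
    fun u hu ↦ ⟨by simp [(hβ _ (hmem u hu)).1], fun t ht ↦ ⟨hfst u hu t ht, hbound u hu t ht⟩⟩, ?_⟩
  -- Both partial derivatives at `(x₀, 0)` are known: zero in `x`, since `W (x, 0) = 0`, and the
  -- identity in `u`, since `W (x₀, u) = u`.
  have hWs : HasStrictFDerivAt W (ContinuousLinearMap.snd ℝ E E) (x₀, 0) := by
    have h1 := hW.hasStrictFDerivAt (by simp)
    have h2 : fderiv ℝ W (x₀, 0) = ContinuousLinearMap.snd ℝ E E := by
      have hx : HasFDerivAt (fun x : E ↦ (x, (0 : E))) (ContinuousLinearMap.inl ℝ E E) x₀ :=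
        (hasFDerivAt_id x₀).prodMk (hasFDerivAt_const _ _)
      have hu : HasFDerivAt (fun u : E ↦ (x₀, u)) (ContinuousLinearMap.inr ℝ E E) 0 :=
        (hasFDerivAt_const _ _).prodMk (hasFDerivAt_id _)
      have hx' := (h1.hasFDerivAt.comp x₀ hx).unique
        ((hasFDerivAt_const (0 : E) x₀).congr_of_eventuallyEq (.of_forall fun x ↦ hW0 x))
      have hu' := (h1.hasFDerivAt.comp (0 : E) hu).unique
        ((hasFDerivAt_id (0 : E)).congr_of_eventuallyEq (.of_forall fun x ↦ hW1 x))
      ext v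
      · simpa using DFunLike.congr_fun hx' v
      · simpa using DFunLike.congr_fun hu' v
    rwa [h2] at h1
  rw [hasStrictFDerivAt_iff_isLittleO, Asymptotics.isLittleO_iff] at hWs
  intro τ hτ
  rw [hasStrictFDerivAt_iff_isLittleO, Asymptotics.isLittleO_iff]
  intro c hc
  set D : ℝ := max L' 1 with hD
  have hDpos : 0 < D := lt_of_lt_of_le one_pos (le_max_right _ _)
  -- The pairs `(x, u)` along two solutions differ by at most `D * ‖u - u'‖`, so this constant
  -- yields the rate `c / ε` in `hle`, hence an error of at most `c * ‖u - u'‖` over times `|t| ≤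
  -- ε`.
  obtain ⟨δ, hδ, hδW⟩ := Metric.eventually_nhds_iff.1 (hWs (c := c / (ε * D)) (by positivity))
  have hρ : 0 < min (r : ℝ) (δ / (2 * D)) := lt_min (by exact_mod_cast hr) (by positivity)
  rw [Metric.eventually_nhds_iff]
  refine ⟨_, hρ, ?_⟩
  rintro ⟨u, u'⟩ huu'
  rw [Prod.dist_eq, max_lt_iff, dist_zero_right, dist_zero_right] at huu'
  have key : ∀ u : E, ‖u‖ < min (r : ℝ) (δ / (2 * D)) → u ∈ closedBall (0 : E) r ∧
      ∀ t ∈ I, dist (((β (x₀, u) t).1, u) : E × E) (x₀, 0) < δ := by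
    intro u hu
    have hu1 := (lt_min_iff.1 hu).1
    have hu2 := (lt_min_iff.1 hu).2
    have hur : u ∈ closedBall (0 : E) r := by simpa using hu1.le
    refine ⟨hur, fun t ht ↦ ?_⟩
    have h1 : D * ‖u‖ < δ := by
      rw [lt_div_iff₀ (by positivity)] at hu2
      nlinarith [norm_nonneg u]
    rw [Prod.dist_eq, max_lt_iff, dist_eq_norm, dist_zero_right]
    constructor
    · exact ((hbound u hur t ht).trans
        (mul_le_mul_of_nonneg_right (le_max_left _ _) (norm_nonneg u))).trans_lt h1
    · refine lt_of_le_of_lt ?_ h1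
      have : 1 * ‖u‖ ≤ D * ‖u‖ := mul_le_mul_of_nonneg_right (le_max_right _ _) (norm_nonneg u)
      rwa [one_mul] at this
  obtain ⟨hu, hud⟩ := key u huu'.1
  obtain ⟨hu', hud'⟩ := key u' huu'.2
  -- Strict differentiability of `W` bounds the derivative of the error term, and the mean value
  -- inequality, starting from the value `0` at time `0`, bounds the error itself.
  have hder : ∀ t ∈ I, HasDerivWithinAt
      (fun s ↦ (β (x₀, u) s).1 - (β (x₀, u') s).1 - s • (u - u'))
      (W ((β (x₀, u) t).1, u) - W ((β (x₀, u') t).1, u') - (1 : ℝ) • (u - u')) I t := fun t ht ↦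
    ((hfst u hu t ht).sub (hfst u' hu' t ht)).sub
      ((hasDerivWithinAt_id t I).smul_const (u - u'))
  have hle : ∀ t ∈ I, ‖W ((β (x₀, u) t).1, u) - W ((β (x₀, u') t).1, u') - (1 : ℝ) • (u - u')‖ ≤
      c / ε * ‖u - u'‖ := by
    intro t ht
    have h1 := hδW (y := (((β (x₀, u) t).1, u), ((β (x₀, u') t).1, u')))
      (by rw [Prod.dist_eq]; exact max_lt (hud t ht) (hud' t ht))
    have h2 : ‖(((β (x₀, u) t).1, u) : E × E) - ((β (x₀, u') t).1, u')‖ ≤ D * ‖u - u'‖ := by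
      rw [Prod.mk_sub_mk, Prod.norm_def]
      refine max_le ((hlip u hu u' hu' t ht).trans
        (mul_le_mul_of_nonneg_right (le_max_left _ _) (norm_nonneg _))) ?_
      have := mul_le_mul_of_nonneg_right (le_max_right (L' : ℝ) 1) (norm_nonneg (u - u'))
      rwa [one_mul] at this
    rw [one_smul]
    refine h1.trans ((mul_le_mul_of_nonneg_left h2 (by positivity)).trans_eq ?_)
    field_simp
  have hfin := hIc.norm_image_sub_le_of_norm_hasDerivWithin_le hder hle hI0 hτ
  have hz : (β (x₀, u) 0).1 - (β (x₀, u') 0).1 - (0 : ℝ) • (u - u') = 0 := by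
    simp [(hβ _ (hmem u hu)).1, (hβ _ (hmem u' hu')).1]
  rw [hz, sub_zero, sub_zero, Real.norm_eq_abs] at hfin
  refine hfin.trans ((mul_le_mul_of_nonneg_left (abs_le.2 hτ) (by positivity)).trans_eq ?_)
  field_simp

end ParametricODE

/-! ### Left translations and left-invariant vector fields. -/

section LeftTranslation

open Bundle

variable {E : Type*} [NormedAddCommGroup E] [NormedSpace ℝ E]
  {G : Type*} [TopologicalSpace G] [ChartedSpace E G] [Group G] [LieGroup 𝓘(ℝ, E) ∞ G]

theorem TangentBundle.mk_congr {M : Type*} [TopologicalSpace M] [ChartedSpace E M] {x y : M}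
    (h : x = y) (v : E) :
    (⟨x, v⟩ : TangentBundle 𝓘(ℝ, E) M) = (⟨y, v⟩ : TangentBundle 𝓘(ℝ, E) M) := by
  subst h; rfl

/-- The field is the tangent map of the multiplication `G × G → G` applied to the zero vector at `g`
and `A` at `1`. The result sits over `g * 1`, whence the change of base point. -/
theorem smooth_mulInvariantVectorField (A : GroupLieAlgebra 𝓘(ℝ, E) G) :
    VecField.Smooth (mulInvariantVectorField A : VecField E G) := by
  let F₁ : G → (TangentBundle 𝓘(ℝ, E) G × TangentBundle 𝓘(ℝ, E) G) :=
    fun g ↦ (TotalSpace.mk' E g 0, TotalSpace.mk' E 1 A)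
  have S₁ : ContMDiff 𝓘(ℝ, E) (𝓘(ℝ, E).tangent.prod 𝓘(ℝ, E).tangent) ∞ F₁ :=
    ContMDiff.prodMk (contMDiff_zeroSection ℝ (TangentSpace 𝓘(ℝ, E) : G → Type _)) contMDiff_const
  let F₂ : (TangentBundle 𝓘(ℝ, E) G × TangentBundle 𝓘(ℝ, E) G) →
      TangentBundle (𝓘(ℝ, E).prod 𝓘(ℝ, E)) (G × G) :=
    (equivTangentBundleProd 𝓘(ℝ, E) G 𝓘(ℝ, E) G).symm
  have S₂ : ContMDiff (𝓘(ℝ, E).tangent.prod 𝓘(ℝ, E).tangent)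
    (𝓘(ℝ, E).prod 𝓘(ℝ, E)).tangent ∞ F₂ := contMDiff_equivTangentBundleProd_symm
  have hm : ContMDiff (𝓘(ℝ, E).prod 𝓘(ℝ, E)) 𝓘(ℝ, E) ∞ (fun p : G × G ↦ p.1 * p.2) :=
    contMDiff_mul 𝓘(ℝ, E) ∞
  have S₃ := hm.contMDiff_tangentMap (m := ∞) le_rfl
  have S := (S₃.comp S₂).comp S₁
  unfold VecField.Smooth
  convert! S using 1
  funext g
  refine (TangentBundle.mk_congr (E := E) (mul_one g).symm (mulInvariantVectorField A g)).trans
    (congrArg (fun v : E ↦ (⟨g * 1, v⟩ : TangentBundle 𝓘(ℝ, E) G)) ?_)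
  let B : E := A
  have h := mfderiv_prod_eq_add_apply (v := ((0 : E), B))
    (hm.mdifferentiable (by simp) (g, (1 : G)))
  refine Eq.symm (Eq.trans h ?_)
  refine (congrArg₂ (fun a b : E ↦ a + b) (ContinuousLinearMap.map_zero _) rfl).trans ?_
  exact zero_add _

theorem mdifferentiableAt_mul_left' (a g : G) :
    MDifferentiableAt 𝓘(ℝ, E) 𝓘(ℝ, E) (fun x : G ↦ a * x) g :=
  (contMDiff_mul_left (I := 𝓘(ℝ, E)) (n := ∞) (a := a)).mdifferentiable (by simp) g

theorem mfderiv_mul_left_leftTranslate (a g : G) (A : GroupLieAlgebra 𝓘(ℝ, E) G) :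
    mfderiv 𝓘(ℝ, E) 𝓘(ℝ, E) (fun x : G ↦ a * x) g (leftTranslate g A) =
      leftTranslate (a * g) A := by
  have h1 : HasMFDerivAt 𝓘(ℝ, E) 𝓘(ℝ, E) (fun x : G ↦ g * x) 1
      (mfderiv 𝓘(ℝ, E) 𝓘(ℝ, E) (fun x : G ↦ g * x) 1) :=
    (mdifferentiableAt_mul_left' g 1).hasMFDerivAt
  have h2 : HasMFDerivAt 𝓘(ℝ, E) 𝓘(ℝ, E) (fun x : G ↦ a * x) (g * 1)
      (mfderiv 𝓘(ℝ, E) 𝓘(ℝ, E) (fun x : G ↦ a * x) (g * 1)) :=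
    (mdifferentiableAt_mul_left' a (g * 1)).hasMFDerivAt
  have h3 := (h2.comp 1 h1).mfderiv
  have h4 : (fun x : G ↦ a * x) ∘ (fun x : G ↦ g * x) = fun x ↦ a * g * x := by
    funext x; simp [mul_assoc]
  rw [h4] at h3
  have h5 := DFunLike.congr_fun h3 A
  rw [mul_one] at h5
  exact h5.symm

theorem leftTranslate_one (A : GroupLieAlgebra 𝓘(ℝ, E) G) : leftTranslate 1 A = A := by
  have h : (fun x : G ↦ 1 * x) = id := by funext x; simp
  unfold leftTranslate
  rw [h]
  exact DFunLike.congr_fun (mfderiv_id (I := 𝓘(ℝ, E)) (x := (1 : G))) A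

/-- The differential at `1` of the left translation by `g`, as a linear isomorphism. -/
def leftTranslateEquiv (g : G) :
    GroupLieAlgebra 𝓘(ℝ, E) G ≃L[ℝ] TangentSpace 𝓘(ℝ, E) g :=
  ContinuousLinearEquiv.equivOfInverse (leftTranslate g)
    (mfderiv 𝓘(ℝ, E) 𝓘(ℝ, E) (fun x : G ↦ g⁻¹ * x) g : E →L[ℝ] E)
    (fun A ↦ by
      refine (mfderiv_mul_left_leftTranslate g⁻¹ g A).trans ?_
      -- The type of a tangent vector depends on its base point, so `g⁻¹ * g` is generalised to a
      -- point `x` before it is identified with `1`.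
      have h : ∀ x : G, x = 1 → (leftTranslate x A : E) = A := by
        rintro x rfl; exact leftTranslate_one A
      exact h _ (inv_mul_cancel g))
    (fun v ↦ by
      have h1 : HasMFDerivAt 𝓘(ℝ, E) 𝓘(ℝ, E) (fun x : G ↦ g⁻¹ * x) g
          (mfderiv 𝓘(ℝ, E) 𝓘(ℝ, E) (fun x : G ↦ g⁻¹ * x) g) :=
        (mdifferentiableAt_mul_left' g⁻¹ g).hasMFDerivAt
      have h2 : HasMFDerivAt 𝓘(ℝ, E) 𝓘(ℝ, E) (fun x : G ↦ g * x) (g⁻¹ * g)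
          (mfderiv 𝓘(ℝ, E) 𝓘(ℝ, E) (fun x : G ↦ g * x) (g⁻¹ * g)) :=
        (mdifferentiableAt_mul_left' g (g⁻¹ * g)).hasMFDerivAt
      have h3 := (h2.comp g h1).mfderiv
      have h4 : (fun x : G ↦ g * x) ∘ (fun x : G ↦ g⁻¹ * x) = id := by
        funext x; simp
      rw [h4, inv_mul_cancel] at h3
      refine (DFunLike.congr_fun h3 v).symm.trans ?_
      exact DFunLike.congr_fun (mfderiv_id (I := 𝓘(ℝ, E)) (x := g)) v)

theorem coe_leftTranslateEquiv (g : G) :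
    (leftTranslateEquiv (E := E) g).toContinuousLinearMap = leftTranslate g := rfl

theorem inverse_leftTranslate_apply (g : G) (A : GroupLieAlgebra 𝓘(ℝ, E) G) :
    (leftTranslate g).inverse (leftTranslate g A) = A := by
  rw [← coe_leftTranslateEquiv, ContinuousLinearMap.inverse_equiv]
  exact (leftTranslateEquiv g).symm_apply_apply A

end LeftTranslation

/-! ### Integral curves of left-invariant fields and the exponential map. -/

section LieExp

open Set

variable {E : Type*} [NormedAddCommGroup E] [NormedSpace ℝ E]
  {G : Type*} [TopologicalSpace G] [ChartedSpace E G] [Group G] [LieGroup 𝓘(ℝ, E) ∞ G]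

theorem contMDiff_one_mulInvariantVectorField (A : GroupLieAlgebra 𝓘(ℝ, E) G) :
    ContMDiff 𝓘(ℝ, E) 𝓘(ℝ, E).tangent 1
      (fun g : G ↦ (⟨g, mulInvariantVectorField A g⟩ : TangentBundle 𝓘(ℝ, E) G)) :=
  (smooth_mulInvariantVectorField A).of_le (by simp)

theorem IsMIntegralCurveOn.mul_left {A : GroupLieAlgebra 𝓘(ℝ, E) G} {γ : ℝ → G} {s : Set ℝ}
    (hγ : IsMIntegralCurveOn (I := 𝓘(ℝ, E)) γ (mulInvariantVectorField A) s) (a : G) :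
    IsMIntegralCurveOn (I := 𝓘(ℝ, E)) (fun t ↦ a * γ t) (mulInvariantVectorField A) s := by
  intro t ht
  have h1 := (mdifferentiableAt_mul_left' (E := E) a (γ t)).hasMFDerivAt.comp_hasMFDerivWithinAt t
    (hγ t ht)
  refine (congrArg (HasMFDerivWithinAt 𝓘(ℝ, ℝ) 𝓘(ℝ, E) (fun t ↦ a * γ t) s t) ?_).mp h1
  refine ContinuousLinearMap.ext fun (r : ℝ) ↦ ?_
  refine (ContinuousLinearMap.map_smul _ _ _).trans ?_
  exact congrArg (fun v : E ↦ r • v) (mfderiv_mul_left_leftTranslate a (γ t) A)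

variable [T2Space G] [CompleteSpace E]

/-- Left translates of one local integral curve through `1` give the same existence time at every
point, and a field with a uniform existence time is complete. -/
theorem exists_isMIntegralCurve_mulInvariantVectorField (A : GroupLieAlgebra 𝓘(ℝ, E) G) :
    ∃ γ : ℝ → G, γ 0 = 1 ∧ IsMIntegralCurve (I := 𝓘(ℝ, E)) γ (mulInvariantVectorField A) := by
  have : IsManifold 𝓘(ℝ, E) 1 G := .of_le (n := ∞) (by simp)
  obtain ⟨γ, h0, hγ⟩ := exists_isMIntegralCurveAt_of_contMDiffAt_boundaryless (t₀ := 0)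
    (contMDiff_one_mulInvariantVectorField A (1 : G))
  rw [isMIntegralCurveAt_iff'] at hγ
  obtain ⟨ε, hε, hγ⟩ := hγ
  rw [Real.ball_eq_Ioo, zero_sub, zero_add] at hγ
  exact exists_isMIntegralCurve_of_isMIntegralCurveOn (contMDiff_one_mulInvariantVectorField A) hε
    (fun g ↦ ⟨fun t ↦ g * γ t, by simp [h0], hγ.mul_left g⟩) 1

/-- `lieExp` uses a chosen curve; uniqueness of integral curves in a Hausdorff manifold removes the
choice. -/
theorem lieExp_eq_of_isMIntegralCurve {A : GroupLieAlgebra 𝓘(ℝ, E) G} {γ : ℝ → G} (h0 : γ 0 = 1)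
    (hγ : IsMIntegralCurve (I := 𝓘(ℝ, E)) γ (mulInvariantVectorField A)) : lieExp A = γ 1 := by
  have : IsManifold 𝓘(ℝ, E) 1 G := .of_le (n := ∞) (by simp)
  have h : ∃ γ : ℝ → G, γ 0 = 1 ∧
    IsMIntegralCurve (I := 𝓘(ℝ, E)) γ (mulInvariantVectorField A) := ⟨γ, h0, hγ⟩
  rw [lieExp, dif_pos h]
  exact congrFun (isMIntegralCurve_Ioo_eq_of_contMDiff_boundaryless (t₀ := 0)
    (contMDiff_one_mulInvariantVectorField A) h.choose_spec.2 hγ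
    (h.choose_spec.1.trans h0.symm)) 1

/-- This evaluates `exp` from a solution known only for short times: it agrees with the global
integral curve `c` of `A`, and `s ↦ c (s * t)` is an integral curve of `t • A`. -/
theorem lieExp_smul_eq_of_isMIntegralCurveOn {A : GroupLieAlgebra 𝓘(ℝ, E) G} {γ : ℝ → G} {ε t : ℝ}
    (h0 : γ 0 = 1)
    (hγ : IsMIntegralCurveOn (I := 𝓘(ℝ, E)) γ (mulInvariantVectorField A) (Ioo (-ε) ε))
    (ht : t ∈ Ioo (-ε) ε) : lieExp (t • A) = γ t := by
  have : IsManifold 𝓘(ℝ, E) 1 G := .of_le (n := ∞) (by simp)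
  obtain ⟨c, hc0, hc⟩ := exists_isMIntegralCurve_mulInvariantVectorField A
  have h1 : c t = γ t := isMIntegralCurveOn_Ioo_eqOn_of_contMDiff_boundaryless (t₀ := 0)
    ⟨by linarith [ht.1, ht.2], by linarith [ht.1, ht.2]⟩
    (contMDiff_one_mulInvariantVectorField A) (hc.isMIntegralCurveOn _) hγ (hc0.trans h0.symm) ht
  have h2 := hc.comp_mul t
  rw [← mulInvariantVectorField_smul] at h2
  rw [lieExp_eq_of_isMIntegralCurve (by simp [hc0]) h2]
  simpa using h1

end LieExp

/-! ### Strict differentiability of the exponential map at zero. -/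

section LieExpDeriv

open Set

variable {E : Type*} [NormedAddCommGroup E] [NormedSpace ℝ E] [FiniteDimensional ℝ E]
  {G : Type*} [TopologicalSpace G] [ChartedSpace E G] [Group G] [LieGroup 𝓘(ℝ, E) ∞ G]

variable (E G) in
/-- The left-invariant vector fields in the preferred chart at `1`, as a function of the point of
the chart and of the value at `1` of the vector field. -/
def chartLeftInvariantField (p : E × E) : E :=
  (mfderiv 𝓘(ℝ, E) 𝓘(ℝ, E) (extChartAt 𝓘(ℝ, E) (1 : G)) ((extChartAt 𝓘(ℝ, E) (1 : G)).symm p.1)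
    : E →L[ℝ] E) (leftTranslate ((extChartAt 𝓘(ℝ, E) (1 : G)).symm p.1) p.2)

/-- For fixed `A` this is the coordinate expression of a smooth vector field. Joint smoothness
follows by linearity in the second variable, through a finite basis of `E`. -/
theorem contDiffAt_chartLeftInvariantField (u₀ : E) :
    ContDiffAt ℝ ∞ (chartLeftInvariantField E G) (extChartAt 𝓘(ℝ, E) (1 : G) 1, u₀) := by
  set φ := extChartAt 𝓘(ℝ, E) (1 : G) with hφ
  have hx₀ : φ 1 ∈ φ.target := φ.map_source (mem_extChartAt_source 1)
  have hsymm : ContMDiffAt 𝓘(ℝ, E) 𝓘(ℝ, E) ∞ φ.symm (φ 1) :=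
    (contMDiffOn_extChartAt_symm (1 : G)).contMDiffAt
      ((isOpen_extChartAt_target (I := 𝓘(ℝ, E)) (1 : G)).mem_nhds hx₀)
  have h1 : ∀ A : E, ContDiffAt ℝ ∞ (fun x ↦ chartLeftInvariantField E G (x, A)) (φ 1) := by
    intro A
    have h2 := (Bundle.contMDiffAt_totalSpace.1 (smooth_mulInvariantVectorField (G := G) A 1)).2
    have h3 : ContMDiffAt 𝓘(ℝ, E) 𝓘(ℝ, E) ∞ _ (φ 1) :=
      ContMDiffAt.comp (φ 1) (by rwa [φ.left_inv (mem_extChartAt_source 1)]) hsymm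
    rw [contMDiffAt_iff_contDiffAt] at h3
    refine h3.congr_of_eventuallyEq ?_
    filter_upwards [(isOpen_extChartAt_target (I := 𝓘(ℝ, E)) (1 : G)).mem_nhds hx₀] with x hx
    have hxs : φ.symm x ∈ (chartAt E (1 : G)).source := by
      have := φ.map_target hx
      rwa [hφ, extChartAt_source] at this
    have h4 := TangentBundle.continuousLinearMapAt_trivializationAt (I := 𝓘(ℝ, E)) hxs
    have h5 := DFunLike.congr_fun h4 (leftTranslate (φ.symm x) A)
    refine h5.symm.trans ?_
    exact Bundle.Trivialization.continuousLinearMapAt_apply_of_mem ℝ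
      (trivializationAt E (TangentSpace 𝓘(ℝ, E)) (1 : G)) (by simpa using hxs) _
  let b := Module.finBasis ℝ E
  have h2 : chartLeftInvariantField E G =
      fun p ↦ ∑ i, b.equivFunL p.2 i • chartLeftInvariantField E G (p.1, b i) := by
    funext p
    let Λ : E →L[ℝ] E := (mfderiv 𝓘(ℝ, E) 𝓘(ℝ, E) φ (φ.symm p.1) : E →L[ℝ] E).comp
      (leftTranslate (φ.symm p.1) : E →L[ℝ] E)
    change Λ p.2 = ∑ i, b.equivFunL p.2 i • Λ (b i)
    conv_lhs => rw [← b.sum_equivFun p.2]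
    rw [map_sum]
    simp only [map_smul]
    rfl
  rw [h2]
  refine ContDiffAt.sum fun i _ ↦ ContDiffAt.smul ?_ ?_
  · have : ContDiff ℝ ∞ (fun p : E × E ↦ b.equivFunL p.2 i) :=
      (contDiff_apply ℝ ℝ i).comp (b.equivFunL.contDiff.comp contDiff_snd)
    exact this.contDiffAt
  · exact (h1 (b i)).comp (φ 1, u₀) contDiffAt_fst

/-- The differentials of the chart and of its inverse cancel, so solutions of the equation in the
chart become integral curves in `G`. -/
theorem isMIntegralCurveOn_of_chart {A : E} {c : ℝ → E} {s : Set ℝ} 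
    (hc : ∀ t ∈ s, c t ∈ (extChartAt 𝓘(ℝ, E) (1 : G)).target ∧
      HasDerivAt c (chartLeftInvariantField E G (c t, A)) t) :
    IsMIntegralCurveOn (I := 𝓘(ℝ, E)) (fun t ↦ (extChartAt 𝓘(ℝ, E) (1 : G)).symm (c t))
      (mulInvariantVectorField (A : GroupLieAlgebra 𝓘(ℝ, E) G)) s := by
  intro t ht
  obtain ⟨htt, hd⟩ := hc t ht
  have h1 : MDifferentiableWithinAt 𝓘(ℝ, E) 𝓘(ℝ, E) (extChartAt 𝓘(ℝ, E) (1 : G)).symm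
      (range 𝓘(ℝ, E)) (c t) := mdifferentiableWithinAt_extChartAt_symm htt
  have h2 := h1.hasMFDerivWithinAt
  have h3 := mfderivWithin_extChartAt_symm_comp_mfderiv_extChartAt (I := 𝓘(ℝ, E)) htt
  have h4 : HasMFDerivAt 𝓘(ℝ, E) 𝓘(ℝ, E) (extChartAt 𝓘(ℝ, E) (1 : G)).symm (c t)
      (mfderivWithin 𝓘(ℝ, E) 𝓘(ℝ, E) (extChartAt 𝓘(ℝ, E) (1 : G)).symm (range 𝓘(ℝ, E)) (c t)) :=
    h2.hasMFDerivAt (by simp)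
  have h5 := h4.comp t hd.hasFDerivAt.hasMFDerivAt
  refine HasMFDerivAt.hasMFDerivWithinAt ?_
  refine (congrArg (HasMFDerivAt 𝓘(ℝ, ℝ) 𝓘(ℝ, E) _ t) ?_).mp h5
  refine ContinuousLinearMap.ext fun (r : ℝ) ↦ ?_
  refine (ContinuousLinearMap.map_smul _ _ _).trans ?_
  exact congrArg (fun v : E ↦ r • v) (DFunLike.congr_fun h3 (leftTranslate _ A))

variable [T2Space G]

variable (E G) in
/-- The exponential map is continuous at `0`, and in the preferred chart at `1` it is strictly
differentiable at `0`, with the identity as derivative. -/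
theorem continuousAt_lieExp_and_hasStrictFDerivAt :
    ContinuousAt (fun u : E ↦ (lieExp (u : GroupLieAlgebra 𝓘(ℝ, E) G) : G)) 0 ∧
    (lieExp (0 : GroupLieAlgebra 𝓘(ℝ, E) G) : G) = 1 ∧
    HasStrictFDerivAt (fun u : E ↦ extChartAt 𝓘(ℝ, E) (1 : G)
      (lieExp (u : GroupLieAlgebra 𝓘(ℝ, E) G))) (ContinuousLinearMap.id ℝ E) 0 := by
  set φ := extChartAt 𝓘(ℝ, E) (1 : G) with hφ
  have hx₀ : φ 1 ∈ φ.target := φ.map_source (mem_extChartAt_source 1)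
  have hto : IsOpen φ.target := isOpen_extChartAt_target (1 : G)
  have hW0 : ∀ x, chartLeftInvariantField E G (x, 0) = 0 := fun x ↦
    (congrArg (mfderiv 𝓘(ℝ, E) 𝓘(ℝ, E) φ (φ.symm x) : E →L[ℝ] E)
      (ContinuousLinearMap.map_zero _)).trans (ContinuousLinearMap.map_zero _)
  -- The preferred chart at `1` has the identity as differential at `1`, since it is the chart that
  -- identifies the tangent space there with `E`.
  have hW1 : ∀ u : E, chartLeftInvariantField E G (φ 1, u) = u := by
    intro u
    have h : ∀ x : G, x = 1 →
        (mfderiv 𝓘(ℝ, E) 𝓘(ℝ, E) φ x : E →L[ℝ] E) (leftTranslate x u) = u := by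
      rintro x rfl
      rw [hφ, mfderiv_extChartAt_self]
      exact leftTranslate_one (G := G) u
    exact h _ (φ.left_inv (mem_extChartAt_source 1))
  obtain ⟨ε, hε, r, hr, α, C, hα, hαd⟩ := exists_solution_hasStrictFDerivAt
    ((contDiffAt_chartLeftInvariantField (G := G) (0 : E)).of_le (by simp)) hW0 hW1
  obtain ⟨ρ, hρ, hρt⟩ := Metric.isOpen_iff.1 hto _ hx₀
  have hC : Filter.Tendsto (fun u : E ↦ C * ‖u‖) (𝓝 0) (𝓝 0) := by
    have : Continuous fun u : E ↦ C * ‖u‖ := by fun_prop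
    simpa using this.tendsto 0
  -- Any nonzero time inside the open interval would do. At time `ε / 2` the solution with parameter
  -- `u` is `exp ((ε / 2) • u)` in the chart, and rescaling `u` by `2 / ε` recovers `exp u`.
  have hτ : ε / 2 ∈ Icc (-ε) ε := ⟨by linarith, by linarith⟩
  have hsmall : ∀ᶠ u : E in 𝓝 0, α u (ε / 2) ∈ φ.target ∧
      lieExp ((ε / 2) • u : GroupLieAlgebra 𝓘(ℝ, E) G) = φ.symm (α u (ε / 2)) := by
    filter_upwards [hC.eventually_lt_const hρ, Metric.closedBall_mem_nhds (0 : E) hr] with u hu hur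
    obtain ⟨h0, h1⟩ := hα u hur
    have ht : ∀ t ∈ Icc (-ε) ε, α u t ∈ φ.target := fun t ht ↦ hρt (by
      rw [Metric.mem_ball, dist_eq_norm]
      exact ((h1 t ht).2).trans_lt hu)
    refine ⟨ht _ hτ, ?_⟩
    refine lieExp_smul_eq_of_isMIntegralCurveOn (γ := fun t ↦ φ.symm (α u t)) (ε := ε) ?_
      (isMIntegralCurveOn_of_chart (G := G) (A := u) (c := α u) fun t ht' ↦ ?_)
      ⟨by linarith, by linarith⟩
    · simp only [h0]; exact φ.left_inv (mem_extChartAt_source 1)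
    · exact ⟨ht t (Ioo_subset_Icc_self ht'),
        (h1 t (Ioo_subset_Icc_self ht')).1.hasDerivAt (Icc_mem_nhds ht'.1 ht'.2)⟩
  have hscale : Filter.Tendsto (fun u : E ↦ (2 / ε) • u) (𝓝 0) (𝓝 0) := by
    simpa using (continuous_const_smul (2 / ε)).tendsto (0 : E)
  have hexp : ∀ᶠ u : E in 𝓝 0, α ((2 / ε) • u) (ε / 2) ∈ φ.target ∧
      (lieExp (u : GroupLieAlgebra 𝓘(ℝ, E) G) : G) = φ.symm (α ((2 / ε) • u) (ε / 2)) := by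
    filter_upwards [hscale.eventually hsmall] with u hu
    refine ⟨hu.1, ?_⟩
    have h := hu.2
    have h2 : (ε / 2) • (2 / ε) • u = u := by
      rw [smul_smul, div_mul_div_comm, mul_comm, div_self (by positivity), one_smul]
    rwa [h2] at h
  have hαs : HasStrictFDerivAt (fun u ↦ α ((2 / ε) • u) (ε / 2)) (ContinuousLinearMap.id ℝ E) 0 := by
    have h1 : HasStrictFDerivAt (fun u : E ↦ (2 / ε) • u) ((2 / ε) • ContinuousLinearMap.id ℝ E) 0 :=
      (hasStrictFDerivAt_id (0 : E)).const_smul (2 / ε)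
    have h2 := hαd _ hτ
    rw [← smul_zero (A := E) (2 / ε)] at h2
    have h3 := h2.comp (0 : E) h1
    convert! h3 using 1
    ext v
    simp [smul_smul]
    field_simp
    simp
  have h00 : α ((2 / ε) • (0 : E)) (ε / 2) = φ 1 := by
    have h0 := (hα 0 (Metric.mem_closedBall_self hr.le)).2 _ hτ
    rw [smul_zero]
    have := h0.2
    rwa [norm_zero, mul_zero, norm_le_zero_iff, sub_eq_zero] at this
  refine ⟨?_, ?_, ?_⟩
  · have h1 : ContinuousAt φ.symm (φ 1) := continuousAt_extChartAt_symm (1 : G)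
    have h2 : ContinuousAt (fun u : E ↦ φ.symm (α ((2 / ε) • u) (ε / 2))) 0 :=
      ContinuousAt.comp (f := fun u : E ↦ α ((2 / ε) • u) (ε / 2)) (by rwa [h00]) hαs.continuousAt
    exact h2.congr (hexp.mono fun u hu ↦ hu.2.symm)
  · have := hexp.self_of_nhds.2
    rw [h00, φ.left_inv (mem_extChartAt_source 1)] at this
    exact this
  · refine hαs.congr_of_eventuallyEq (hexp.mono fun u hu ↦ ?_)
    simp only
    rw [hu.2, φ.right_inv hu.1]

end LieExpDeriv

/-! ### Translations of `G/H` and the differential of the projection. -/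

section HomogeneousSpace

variable {E : Type*} [NormedAddCommGroup E] [NormedSpace ℝ E]
  {G : Type*} [TopologicalSpace G] [ChartedSpace E G] [Group G] [LieGroup 𝓘(ℝ, E) ∞ G]
  {F : Type*} [NormedAddCommGroup F] [NormedSpace ℝ F] {H : Subgroup G}
  [ChartedSpace F (G ⧸ H)] [IsManifold 𝓘(ℝ, F) ∞ (G ⧸ H)]

/-- Smoothness descends through `π` from `τ_a ∘ π = π ∘ L_a`. -/
theorem contMDiff_smul_quotient (hπ : Manifold.IsSubmersion 𝓘(ℝ, E) 𝓘(ℝ, F) ∞ (cosetProj H))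
    (a : G) : ContMDiff 𝓘(ℝ, F) 𝓘(ℝ, F) ∞ (fun q : G ⧸ H ↦ a • q) :=
  hπ.contMDiff_of_comp QuotientGroup.mk_surjective
    (hπ.contMDiff.comp (contMDiff_mul_left (I := 𝓘(ℝ, E)) (n := ∞) (a := a)))

theorem hasMFDerivAt_smul_quotient
    (hπ : Manifold.IsSubmersion 𝓘(ℝ, E) 𝓘(ℝ, F) ∞ (cosetProj H)) (a : G) (q : G ⧸ H) :
    HasMFDerivAt 𝓘(ℝ, F) 𝓘(ℝ, F) (fun q : G ⧸ H ↦ a • q) q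
      (mfderiv 𝓘(ℝ, F) 𝓘(ℝ, F) (fun q : G ⧸ H ↦ a • q) q) :=
  ((contMDiff_smul_quotient hπ a).mdifferentiable (by simp) q).hasMFDerivAt

theorem hasMFDerivAt_cosetProj
    (hπ : Manifold.IsSubmersion 𝓘(ℝ, E) 𝓘(ℝ, F) ∞ (cosetProj H)) (g : G) :
    HasMFDerivAt 𝓘(ℝ, E) 𝓘(ℝ, F) (cosetProj H) g
      (mfderiv 𝓘(ℝ, E) 𝓘(ℝ, F) (cosetProj H) g) :=
  (hπ.contMDiff.mdifferentiable (by simp) g).hasMFDerivAt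

theorem mfderiv_cosetProj_leftTranslate
    (hπ : Manifold.IsSubmersion 𝓘(ℝ, E) 𝓘(ℝ, F) ∞ (cosetProj H)) (g : G)
    (A : GroupLieAlgebra 𝓘(ℝ, E) G) :
    mfderiv 𝓘(ℝ, E) 𝓘(ℝ, F) (cosetProj H) g (leftTranslate g A) =
      cosetTranslate F H g (cosetProjDeriv E F H A) := by
  have h1 := (hasMFDerivAt_cosetProj hπ (g * 1)).comp 1
    (mdifferentiableAt_mul_left' (E := E) g 1).hasMFDerivAt
  have h2 := (hasMFDerivAt_smul_quotient hπ g (cosetProj H 1)).comp 1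
    (hasMFDerivAt_cosetProj hπ 1)
  have h3 := DFunLike.congr_fun (hasMFDerivAt_unique h1 h2) A
  rw [mul_one] at h3
  exact h3

theorem mfderiv_smul_quotient_cosetTranslate
    (hπ : Manifold.IsSubmersion 𝓘(ℝ, E) 𝓘(ℝ, F) ∞ (cosetProj H)) (a g : G)
    (w : TangentSpace 𝓘(ℝ, F) (cosetProj H 1)) :
    mfderiv 𝓘(ℝ, F) 𝓘(ℝ, F) (fun q : G ⧸ H ↦ a • q) (cosetProj H g) (cosetTranslate F H g w) =
      cosetTranslate F H (a * g) w := by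
  have h1 := (hasMFDerivAt_smul_quotient hπ a (g • cosetProj H 1)).comp (cosetProj H 1)
    (hasMFDerivAt_smul_quotient hπ g (cosetProj H 1))
  have h2 := hasMFDerivAt_smul_quotient hπ (a * g) (cosetProj H 1)
  have h3 : (fun q : G ⧸ H ↦ a • q) ∘ (fun q : G ⧸ H ↦ g • q) = fun q ↦ (a * g) • q := by
    funext q; simp [mul_smul]
  rw [h3] at h1
  have h4 : g • cosetProj H 1 = cosetProj H g := by simp [cosetProj]
  have h5 := DFunLike.congr_fun (hasMFDerivAt_unique h1 h2) w
  rw [h4] at h5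
  exact h5

theorem cosetTranslate_one (w : TangentSpace 𝓘(ℝ, F) (cosetProj H 1)) :
    cosetTranslate F H 1 w = w := by
  have h : (fun q : G ⧸ H ↦ (1 : G) • q) = id := by funext q; simp
  unfold cosetTranslate
  rw [h]
  exact DFunLike.congr_fun (mfderiv_id (I := 𝓘(ℝ, F)) (x := cosetProj H (1 : G))) w

theorem mfderiv_smul_quotient_inv_apply
    (hπ : Manifold.IsSubmersion 𝓘(ℝ, E) 𝓘(ℝ, F) ∞ (cosetProj H)) (a : G) {q q' : G ⧸ H}
    (hq : a • q = q') (v : F) :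
    (mfderiv 𝓘(ℝ, F) 𝓘(ℝ, F) (fun q : G ⧸ H ↦ a⁻¹ • q) q' : F →L[ℝ] F)
      ((mfderiv 𝓘(ℝ, F) 𝓘(ℝ, F) (fun q : G ⧸ H ↦ a • q) q : F →L[ℝ] F) v) = v := by
  subst hq
  have h1 := (hasMFDerivAt_smul_quotient hπ a⁻¹ (a • q)).comp q
    (hasMFDerivAt_smul_quotient hπ a q)
  have h3 : (fun q : G ⧸ H ↦ a⁻¹ • q) ∘ (fun q : G ⧸ H ↦ a • q) = id := by
    funext q; simp
  rw [h3] at h1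
  exact DFunLike.congr_fun (hasMFDerivAt_unique h1 (hasMFDerivAt_id q)) v

/-- The differential at `q` of the translation `τ_a` of `G/H`, as a linear isomorphism. -/
def smulQuotientEquiv (hπ : Manifold.IsSubmersion 𝓘(ℝ, E) 𝓘(ℝ, F) ∞ (cosetProj H)) (a : G)
    (q : G ⧸ H) : F ≃L[ℝ] F :=
  ContinuousLinearEquiv.equivOfInverse
    (mfderiv 𝓘(ℝ, F) 𝓘(ℝ, F) (fun q : G ⧸ H ↦ a • q) q)
    (mfderiv 𝓘(ℝ, F) 𝓘(ℝ, F) (fun q : G ⧸ H ↦ a⁻¹ • q) (a • q))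
    (fun v ↦ mfderiv_smul_quotient_inv_apply hπ a rfl v)
    (fun v ↦ by
      have := mfderiv_smul_quotient_inv_apply hπ a⁻¹ (q := a • q) (q' := q) (by simp) v
      rwa [inv_inv] at this)

theorem inverse_mfderiv_smul_quotient_apply
    (hπ : Manifold.IsSubmersion 𝓘(ℝ, E) 𝓘(ℝ, F) ∞ (cosetProj H)) (a : G) (q : G ⧸ H) (v : F) :
    (mfderiv 𝓘(ℝ, F) 𝓘(ℝ, F) (fun q : G ⧸ H ↦ a • q) q : F →L[ℝ] F).inverse
      ((mfderiv 𝓘(ℝ, F) 𝓘(ℝ, F) (fun q : G ⧸ H ↦ a • q) q : F →L[ℝ] F) v) = v := by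
  change (smulQuotientEquiv hπ a q).toContinuousLinearMap.inverse (smulQuotientEquiv hπ a q v) = v
  rw [ContinuousLinearMap.inverse_equiv]
  exact (smulQuotientEquiv hπ a q).symm_apply_apply v

/-- The fibre of `π` through `1` is `H`: a vertical vector at `1` is the velocity of a curve in this
fibre, and conversely `π` is constant along curves in `H`. -/
theorem cosetProjDeriv_eq_zero_iff
    (hπ : Manifold.IsSubmersion 𝓘(ℝ, E) 𝓘(ℝ, F) ∞ (cosetProj H))
    (A : GroupLieAlgebra 𝓘(ℝ, E) G) :
    cosetProjDeriv E F H A = 0 ↔ A ∈ closedSubgroupLieAlgebra E H := by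
  constructor
  · intro h
    obtain ⟨c, hc, hc0, hcH, hcA⟩ := hπ.exists_curve 1 A h
    refine ⟨c, hc, hc0, ?_, hcA⟩
    filter_upwards [hcH] with t ht
    simpa using (QuotientGroup.eq.1 ht.symm)
  · rintro ⟨c, hc, hc0, hcH, hcA⟩
    have h1 : HasMFDerivAt 𝓘(ℝ, ℝ) 𝓘(ℝ, E) c 0 (mfderiv 𝓘(ℝ, ℝ) 𝓘(ℝ, E) c 0) :=
      (hc.mdifferentiableAt (by simp)).hasMFDerivAt
    have h2 := (hasMFDerivAt_cosetProj hπ (c 0)).comp (0 : ℝ) h1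
    have h3 : HasMFDerivAt 𝓘(ℝ, ℝ) 𝓘(ℝ, F) (fun _ : ℝ ↦ cosetProj H (1 : G)) 0
      (0 : TangentSpace 𝓘(ℝ, ℝ) (0 : ℝ) →L[ℝ] TangentSpace 𝓘(ℝ, F) (cosetProj H (1 : G))) :=
      hasMFDerivAt_const _ _
    have h4 := h2.congr_of_eventuallyEq (f₁ := fun _ : ℝ ↦ cosetProj H (1 : G)) (by
      filter_upwards [hcH] with t ht
      exact QuotientGroup.eq.2 (by simpa using ht))
    have h5 := DFunLike.congr_fun (hasMFDerivAt_unique h4 h3) (1 : ℝ)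
    rw [hc0] at h5
    have h6 : (mfderiv 𝓘(ℝ, E) 𝓘(ℝ, F) (cosetProj H) (1 : G) : E →L[ℝ] F)
      (initialVelocity E c) = 0 := h5
    rw [hcA] at h6
    exact h6

/-- The section of `dπ` at the origin with image a complement of the Lie algebra of `H`. -/
theorem exists_lift_cosetProjDeriv [FiniteDimensional ℝ F]
    (hπ : Manifold.IsSubmersion 𝓘(ℝ, E) 𝓘(ℝ, F) ∞ (cosetProj H))
    {m : Submodule ℝ (GroupLieAlgebra 𝓘(ℝ, E) G)}
    (hm : IsCompl (closedSubgroupLieAlgebra E H) m) :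
    ∃ ι : F →L[ℝ] E, (∀ w, (cosetProjDeriv E F H (ι w) : F) = w) ∧ (∀ w, ι w ∈ m) ∧
      ∀ A ∈ m, ι (cosetProjDeriv E F H A) = A := by
  let P : E →ₗ[ℝ] F := (cosetProjDeriv E F H : E →L[ℝ] F).toLinearMap
  let m' : Submodule ℝ E := m
  have hker : ∀ A : E, P A = 0 ↔ A ∈ closedSubgroupLieAlgebra E H := fun A ↦
    cosetProjDeriv_eq_zero_iff hπ A
  have hinj : Function.Injective (P.domRestrict m') := by
    rw [← LinearMap.ker_eq_bot, LinearMap.ker_eq_bot']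
    rintro ⟨A, hA⟩ h
    have h1 : A ∈ closedSubgroupLieAlgebra E H := (hker A).1 h
    exact Subtype.ext (Submodule.disjoint_def.1 hm.disjoint A h1 hA)
  have hsurj : Function.Surjective (P.domRestrict m') := by
    intro w
    obtain ⟨A, hA⟩ := hπ.mfderiv_surjective (1 : G) w
    obtain ⟨B, hB, C, hC, hBC⟩ := Submodule.mem_sup.1
      (hm.sup_eq_top ▸ Submodule.mem_top : A ∈ closedSubgroupLieAlgebra E H ⊔ m)
    refine ⟨⟨C, hC⟩, ?_⟩
    have h1 : P A = w := hA
    have h2 : P B = 0 := (hker B).2 hB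
    have h3 : P A = P B + P C := (congrArg P hBC.symm).trans (map_add P (B : E) (C : E))
    change P C = w
    rw [← h1, h3, h2, zero_add]
  let e := LinearEquiv.ofBijective _ ⟨hinj, hsurj⟩
  refine ⟨LinearMap.toContinuousLinearMap (m'.subtype ∘ₗ e.symm.toLinearMap), fun w ↦ ?_,
    fun w ↦ (e.symm w).2, fun A hA ↦ ?_⟩
  · exact e.apply_symm_apply w
  · exact congrArg Subtype.val (e.symm_apply_apply ⟨A, hA⟩)

end HomogeneousSpace

/-! ### The section of the projection given by the exponential map on `m`. -/

section ExponentialSection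

variable {E : Type*} [NormedAddCommGroup E] [NormedSpace ℝ E] [FiniteDimensional ℝ E]
  {G : Type*} [TopologicalSpace G] [T2Space G] [ChartedSpace E G] [Group G]
  [LieGroup 𝓘(ℝ, E) ∞ G]
  {F : Type*} [NormedAddCommGroup F] [NormedSpace ℝ F] [FiniteDimensional ℝ F] {H : Subgroup G}
  [ChartedSpace F (G ⧸ H)] [IsManifold 𝓘(ℝ, F) ∞ (G ⧸ H)]

theorem hasMFDerivAt_extChartAt_self {M : Type*} [TopologicalSpace M] [ChartedSpace E M]
    [IsManifold 𝓘(ℝ, E) ∞ M] (x : M) :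
    HasMFDerivAt 𝓘(ℝ, E) 𝓘(ℝ, E) (extChartAt 𝓘(ℝ, E) x) x (ContinuousLinearMap.id ℝ E) := by
  have : IsManifold 𝓘(ℝ, E) 1 M := .of_le (n := ∞) (by simp)
  have h := (contMDiffAt_extChartAt (I := 𝓘(ℝ, E)) (n := ∞) (x := x)).mdifferentiableAt
    (by simp) |>.hasMFDerivAt
  rw [mfderiv_extChartAt_self] at h
  exact h

theorem hasMFDerivAt_extChartAt_symm_self {M : Type*} [TopologicalSpace M] [ChartedSpace E M]
    [IsManifold 𝓘(ℝ, E) ∞ M] (x : M) :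
    HasMFDerivAt 𝓘(ℝ, E) 𝓘(ℝ, E) (extChartAt 𝓘(ℝ, E) x).symm (extChartAt 𝓘(ℝ, E) x x)
      (ContinuousLinearMap.id ℝ E) := by
  have : IsManifold 𝓘(ℝ, E) 1 M := .of_le (n := ∞) (by simp)
  have h := (mdifferentiableWithinAt_extChartAt_symm (I := 𝓘(ℝ, E))
    ((extChartAt 𝓘(ℝ, E) x).map_source (mem_extChartAt_source x))).hasMFDerivWithinAt
  rw [mfderivWithin_range_extChartAt_symm] at h
  exact h.hasMFDerivAt (by simp)

/-- There is a section of `π` that is differentiable at the origin and inverse to `π` on the set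
of all `exp u` with `u` in a neighbourhood of `0` in `m`. -/
theorem exists_exponential_section
    (hπ : Manifold.IsSubmersion 𝓘(ℝ, E) 𝓘(ℝ, F) ∞ (cosetProj H))
    {m : Submodule ℝ (GroupLieAlgebra 𝓘(ℝ, E) G)} {ι : F →L[ℝ] E}
    (hι : ∀ w, (cosetProjDeriv E F H (ι w) : F) = w)
    (hιm : ∀ A ∈ m, ι (cosetProjDeriv E F H A) = A) :
    ∃ σ : G ⧸ H → G, (∀ q, cosetProj H (σ q) = q) ∧ σ (cosetProj H 1) = 1 ∧
      HasMFDerivAt 𝓘(ℝ, F) 𝓘(ℝ, E) σ (cosetProj H 1) ι ∧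
      ∀ᶠ u : m in 𝓝 0, σ (cosetProj H (lieExp (u : GroupLieAlgebra 𝓘(ℝ, E) G))) =
        lieExp (u : GroupLieAlgebra 𝓘(ℝ, E) G) := by
  let P : E →L[ℝ] F := cosetProjDeriv E F H
  obtain ⟨hec, he0, hed⟩ := continuousAt_lieExp_and_hasStrictFDerivAt E G
  set φ := extChartAt 𝓘(ℝ, E) (1 : G) with hφ
  set o : G ⧸ H := cosetProj H 1 with ho
  set ψ := extChartAt 𝓘(ℝ, F) o with hψ
  let ex : F → G := fun w ↦ lieExp (ι w : GroupLieAlgebra 𝓘(ℝ, E) G)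
  have hex0 : ex 0 = 1 := by
    have h : (ι 0 : E) = 0 := map_zero ι
    exact (congrArg (fun A : E ↦ (lieExp (A : GroupLieAlgebra 𝓘(ℝ, E) G) : G)) h).trans he0
  have hexc : ContinuousAt ex 0 :=
    ContinuousAt.comp (f := ι) (g := fun u : E ↦ (lieExp (u : GroupLieAlgebra 𝓘(ℝ, E) G) : G))
      (by rwa [map_zero]) ι.continuous.continuousAt
  have hexs : HasStrictFDerivAt (fun w ↦ φ (ex w)) ι 0 := by
    have h1 : HasStrictFDerivAt ι ι (0 : F) := ι.hasStrictFDerivAt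
    rw [← map_zero ι] at hed
    exact hed.comp (0 : F) h1
  have hexφ : ∀ᶠ w in 𝓝 0, ex w ∈ φ.source :=
    hexc.eventually_mem (by rw [hex0]; exact extChartAt_source_mem_nhds (1 : G))
  have hexd : HasMFDerivAt 𝓘(ℝ, F) 𝓘(ℝ, E) ex 0 ι := by
    have h1 := hasMFDerivAt_extChartAt_symm_self (1 : G) (E := E)
    have h2 : HasMFDerivAt 𝓘(ℝ, E) 𝓘(ℝ, E) φ.symm (φ (ex 0)) (ContinuousLinearMap.id ℝ E) := by
      rw [hex0]; exact h1
    have h3 := h2.comp (0 : F) hexs.hasFDerivAt.hasMFDerivAt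
    exact h3.congr_of_eventuallyEq (hexφ.mono fun w hw ↦ (φ.left_inv hw).symm)
  let Φ : F → F := fun w ↦ ψ (cosetProj H (ex w))
  have hΦ0 : Φ 0 = ψ o := by simp only [Φ, hex0, ho]
  have hπl : HasStrictFDerivAt (fun x ↦ ψ (cosetProj H (φ.symm x)))
      P (φ 1) := by
    have hl : φ.symm (φ 1) = 1 := φ.left_inv (mem_extChartAt_source 1)
    have h1 : ContMDiffAt 𝓘(ℝ, E) 𝓘(ℝ, E) ∞ φ.symm (φ 1) :=
      (contMDiffOn_extChartAt_symm (1 : G)).contMDiffAt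
        ((isOpen_extChartAt_target (I := 𝓘(ℝ, E)) (1 : G)).mem_nhds
          (φ.map_source (mem_extChartAt_source 1)))
    have h2 : ContMDiffAt 𝓘(ℝ, E) 𝓘(ℝ, F) ∞ (cosetProj H) (φ.symm (φ 1)) := hπ.contMDiff _
    have h3 : ContMDiffAt 𝓘(ℝ, F) 𝓘(ℝ, F) ∞ ψ (cosetProj H (φ.symm (φ 1))) := by
      rw [hl]; exact contMDiffAt_extChartAt
    have h4 : ContDiffAt ℝ ∞ (fun x ↦ ψ (cosetProj H (φ.symm x))) (φ 1) :=
      contMDiffAt_iff_contDiffAt.1 (ContMDiffAt.comp (φ 1) h3 (h2.comp (φ 1) h1))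
    have h5 := h4.hasStrictFDerivAt (by simp)
    have g1 := hasMFDerivAt_extChartAt_symm_self (1 : G) (E := E)
    have g2 : HasMFDerivAt 𝓘(ℝ, E) 𝓘(ℝ, F) (cosetProj H) (φ.symm (φ 1))
        P := by
      rw [hl]; exact hasMFDerivAt_cosetProj hπ 1
    have g3 : HasMFDerivAt 𝓘(ℝ, F) 𝓘(ℝ, F) ψ (cosetProj H (φ.symm (φ 1)))
        (ContinuousLinearMap.id ℝ F) := by
      rw [hl]; exact hasMFDerivAt_extChartAt_self o
    have g4 := g3.comp (φ 1) (g2.comp (φ 1) g1)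
    have g5 : HasFDerivAt (fun x ↦ ψ (cosetProj H (φ.symm x)))
      P (φ 1) := hasMFDerivAt_iff_hasFDerivAt.1 g4
    rwa [g5.fderiv] at h5
  -- In charts, `w ↦ π (exp (ι w))` has derivative `P ∘ ι = id` at `0`, so the inverse function
  -- theorem applies; it needs strict differentiability at this point only.
  have hΦ : HasStrictFDerivAt Φ (ContinuousLinearEquiv.refl ℝ F : F →L[ℝ] F) 0 := by
    have h1 : HasStrictFDerivAt (fun x ↦ ψ (cosetProj H (φ.symm x)))
      P (φ (ex 0)) := by rwa [hex0]
    have h2 := h1.comp (0 : F) hexs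
    have h3 : P.comp ι =
        (ContinuousLinearEquiv.refl ℝ F : F →L[ℝ] F) := ContinuousLinearMap.ext hι
    rw [h3] at h2
    refine h2.congr_of_eventuallyEq (hexφ.mono fun w hw ↦ ?_)
    exact congrArg (fun g : G ↦ ψ (cosetProj H g)) (φ.left_inv hw)
  let inv : F → F := hΦ.localInverse Φ _ 0
  have hinv : HasStrictFDerivAt inv (ContinuousLinearMap.id ℝ F) (ψ o) := by
    have := hΦ.to_localInverse
    rw [hΦ0] at this
    exact this
  have hinv0 : inv (ψ o) = 0 := by
    rw [← hΦ0]; exact hΦ.localInverse_apply_image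
  have hright : ∀ᶠ y in 𝓝 (ψ o), Φ (inv y) = y := by
    rw [← hΦ0]; exact hΦ.eventually_right_inverse
  have hleft : ∀ᶠ w in 𝓝 0, inv (Φ w) = w := hΦ.eventually_left_inverse
  let s : G ⧸ H → G := fun q ↦ ex (inv (ψ q))
  have hψc : ContinuousAt ψ o := continuousAt_extChartAt o
  have hiψ : ContinuousAt (fun q ↦ inv (ψ q)) o := hinv.continuousAt.comp hψc
  have hso : s o = 1 := by simp only [s, hinv0, hex0]
  have hsd : HasMFDerivAt 𝓘(ℝ, F) 𝓘(ℝ, E) s o ι := by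
    have h1 : HasMFDerivAt 𝓘(ℝ, F) 𝓘(ℝ, E) ex (inv (ψ o)) ι := by rwa [hinv0]
    exact h1.comp o (hinv.hasFDerivAt.hasMFDerivAt.comp o (hasMFDerivAt_extChartAt_self o))
  have hπs : ∀ᶠ q in 𝓝 o, cosetProj H (s q) = q := by
    have h1 : ContinuousAt (fun q ↦ cosetProj H (s q)) o :=
      (hπ.contMDiff.continuous.continuousAt).comp hsd.continuousAt
    have h2 : ∀ᶠ q in 𝓝 o, cosetProj H (s q) ∈ ψ.source :=
      h1.eventually_mem (by simp only [hso]; exact extChartAt_source_mem_nhds o)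
    have h3 : ∀ᶠ q in 𝓝 o, q ∈ ψ.source := extChartAt_source_mem_nhds o
    filter_upwards [h2, h3, hψc.eventually hright] with q hq2 hq3 hq
    exact ψ.injOn hq2 hq3 hq
  have hsexp : ∀ᶠ w in 𝓝 0, s (cosetProj H (ex w)) = ex w := by
    filter_upwards [hleft] with w hw using congrArg ex hw
  classical
  -- Away from the origin any representative is taken. A section defined everywhere makes the later
  -- formula for the pulled back field an identity on all of `G/H`, so no locality argument is
  -- needed.
  let σ : G ⧸ H → G := fun q ↦ if cosetProj H (s q) = q then s q else q.out
  have hσs : ∀ q, cosetProj H (s q) = q → σ q = s q := fun q hq ↦ if_pos hq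
  have hoo : cosetProj H (s o) = o := by rw [hso]
  refine ⟨σ, fun q ↦ ?_, (hσs o hoo).trans hso, ?_, ?_⟩
  · by_cases hq : cosetProj H (s q) = q
    · rw [hσs q hq, hq]
    · simp only [σ, if_neg hq]
      exact Quotient.out_eq' q
  · exact hsd.congr_of_eventuallyEq (hπs.mono hσs)
  · let c : m → F := fun u ↦ (cosetProjDeriv E F H) (u : GroupLieAlgebra 𝓘(ℝ, E) G)
    have hc0 : c 0 = 0 := ContinuousLinearMap.map_zero (cosetProjDeriv E F H)
    have hc : Filter.Tendsto c (𝓝 0) (𝓝 0) := by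
      have h1 : Continuous c := (cosetProjDeriv E F H).continuous.comp continuous_subtype_val
      have h2 := h1.tendsto 0
      rwa [hc0] at h2
    have hexc' : ContinuousAt (fun w ↦ cosetProj H (ex w)) 0 :=
      (hπ.contMDiff.continuous.continuousAt).comp hexc
    have h1 : ∀ᶠ w in 𝓝 0, cosetProj H (s (cosetProj H (ex w))) = cosetProj H (ex w) :=
      hexc'.eventually (by simpa only [hex0] using hπs)
    filter_upwards [hc.eventually h1, hc.eventually hsexp] with u hu1 hu2
    have hu : ex (c u) = lieExp (u : GroupLieAlgebra 𝓘(ℝ, E) G) :=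
      congrArg (fun A : E ↦ (lieExp (A : GroupLieAlgebra 𝓘(ℝ, E) G) : G)) (hιm u u.2)
    rw [← hu, hσs _ hu1, hu2]

end ExponentialSection

/-! ### Horizontal lifts, horizontal projections and smooth coefficients. -/

section HorizontalLift

variable {E : Type*} [NormedAddCommGroup E] [NormedSpace ℝ E] [FiniteDimensional ℝ E]

/-- `ContinuousLinearMap.inverse` has the default value `0` on non-invertible maps, so `dp`
restricted to `D x` is first shown to be an isomorphism; the horizontal lift is then characterised
by its defining property. -/
theorem horizontalLift_eq {M : Type*} [TopologicalSpace M] [ChartedSpace E M]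
    {F : Type*} [NormedAddCommGroup F] [NormedSpace ℝ F]
    {N : Type*} [TopologicalSpace N] [ChartedSpace F N] {p : M → N}
    {D : (x : M) → Submodule ℝ (TangentSpace 𝓘(ℝ, E) x)} {X : VecField F N} {x : M}
    (hD : IsCompl (D x) (mfderiv 𝓘(ℝ, E) 𝓘(ℝ, F) p x).ker)
    (hp : Function.Surjective (mfderiv 𝓘(ℝ, E) 𝓘(ℝ, F) p x)) {v : TangentSpace 𝓘(ℝ, E) x}
    (hv : v ∈ D x) (hvX : mfderiv 𝓘(ℝ, E) 𝓘(ℝ, F) p x v = X (p x)) :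
    horizontalLift p D X x = v := by
  let D' : Submodule ℝ E := D x
  let P : E →L[ℝ] F := mfderiv 𝓘(ℝ, E) 𝓘(ℝ, F) p x
  let P' : D' →L[ℝ] F := P.comp D'.subtypeL
  have hinj : Function.Injective P'.toLinearMap := by
    rw [← LinearMap.ker_eq_bot, LinearMap.ker_eq_bot']
    rintro ⟨A, hA⟩ h
    exact Subtype.ext (Submodule.disjoint_def.1 hD.disjoint A hA h)
  have hsurj : Function.Surjective P'.toLinearMap := by
    intro w
    obtain ⟨A, hA⟩ := hp w
    obtain ⟨B, hB, C, hC, hBC⟩ := Submodule.mem_sup.1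
      (hD.sup_eq_top ▸ Submodule.mem_top : A ∈ D x ⊔ (mfderiv 𝓘(ℝ, E) 𝓘(ℝ, F) p x).ker)
    refine ⟨⟨B, hB⟩, ?_⟩
    have h1 : P A = w := hA
    have h2 : P C = 0 := hC
    have h3 : P A = P B + P C := (congrArg P hBC.symm).trans (map_add P (B : E) (C : E))
    change P B = w
    rw [← h1, h3, h2, add_zero]
  let e := (LinearEquiv.ofBijective P'.toLinearMap ⟨hinj, hsurj⟩).toContinuousLinearEquiv
  have he : P' = e.toContinuousLinearMap := by ext; rfl
  change ((P'.inverse (X (p x)) : D') : E) = v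
  rw [he, ContinuousLinearMap.inverse_equiv]
  have h : e ⟨v, hv⟩ = X (p x) := hvX
  rw [← h]
  exact congrArg Subtype.val (e.symm_apply_apply ⟨v, hv⟩)

variable {G : Type*} [TopologicalSpace G] [ChartedSpace E G] [Group G]
  [LieGroup 𝓘(ℝ, E) ∞ G]
  {F : Type*} [NormedAddCommGroup F] [NormedSpace ℝ F] [FiniteDimensional ℝ F] {H : Subgroup G}
  [ChartedSpace F (G ⧸ H)] [IsManifold 𝓘(ℝ, F) ∞ (G ⧸ H)]

theorem isSmoothDistribution_leftInvariantDistribution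
    (m : Submodule ℝ (GroupLieAlgebra 𝓘(ℝ, E) G)) :
    IsSmoothDistribution (leftInvariantDistribution m) := by
  rintro g v ⟨A, hA, rfl⟩
  exact ⟨mulInvariantVectorField A, rfl, .of_forall fun x ↦ ⟨A, hA, rfl⟩,
    smooth_mulInvariantVectorField A g⟩

theorem exists_leftTranslate_eq (g : G) (v : TangentSpace 𝓘(ℝ, E) g) :
    ∃ A : GroupLieAlgebra 𝓘(ℝ, E) G, leftTranslate g A = v :=
  ⟨(leftTranslateEquiv g).symm v, (leftTranslateEquiv g).apply_symm_apply v⟩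

theorem mfderiv_cosetProj_leftTranslate_eq_zero_iff
    (hπ : Manifold.IsSubmersion 𝓘(ℝ, E) 𝓘(ℝ, F) ∞ (cosetProj H)) (g : G)
    (A : GroupLieAlgebra 𝓘(ℝ, E) G) :
    mfderiv 𝓘(ℝ, E) 𝓘(ℝ, F) (cosetProj H) g (leftTranslate g A) = 0 ↔
      A ∈ closedSubgroupLieAlgebra E H := by
  rw [mfderiv_cosetProj_leftTranslate hπ, ← cosetProjDeriv_eq_zero_iff hπ]
  exact (smulQuotientEquiv hπ g (cosetProj H 1)).map_eq_zero_iff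

theorem isCompl_leftInvariantDistribution
    (hπ : Manifold.IsSubmersion 𝓘(ℝ, E) 𝓘(ℝ, F) ∞ (cosetProj H))
    {m : Submodule ℝ (GroupLieAlgebra 𝓘(ℝ, E) G)}
    (hm : IsCompl (closedSubgroupLieAlgebra E H) m) (g : G) :
    IsCompl (leftInvariantDistribution m g) (mfderiv 𝓘(ℝ, E) 𝓘(ℝ, F) (cosetProj H) g).ker := by
  constructor
  · rw [Submodule.disjoint_def]
    rintro v ⟨A, hA, rfl⟩ hv
    have h1 := (mfderiv_cosetProj_leftTranslate_eq_zero_iff hπ g A).1 hv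
    have h2 : A = 0 := Submodule.disjoint_def.1 hm.disjoint A h1 hA
    rw [h2]
    exact ContinuousLinearMap.map_zero _
  · rw [codisjoint_iff, Submodule.eq_top_iff']
    intro v
    obtain ⟨A, rfl⟩ := exists_leftTranslate_eq g v
    obtain ⟨B, hB, C, hC, rfl⟩ := Submodule.mem_sup.1
      (hm.sup_eq_top ▸ Submodule.mem_top : A ∈ closedSubgroupLieAlgebra E H ⊔ m)
    rw [map_add, add_comm]
    exact Submodule.add_mem_sup ⟨C, hC, rfl⟩
      ((mfderiv_cosetProj_leftTranslate_eq_zero_iff hπ g B).2 hB)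

theorem horizontalPart_leftTranslate {h m : Submodule ℝ (GroupLieAlgebra 𝓘(ℝ, E) G)}
    (hm : IsCompl h m) (g : G) (A : GroupLieAlgebra 𝓘(ℝ, E) G) :
    horizontalPart hm g (leftTranslate g A) = leftTranslate g (m.projection h hm.symm A) := by
  rw [horizontalPart, inverse_leftTranslate_apply]

/-- The vertical space at `g` is the left translate of the Lie algebra of `H`, so the projections in
the two halves of the final statement coincide. -/
theorem projection_ker_eq_horizontalPart
    (hπ : Manifold.IsSubmersion 𝓘(ℝ, E) 𝓘(ℝ, F) ∞ (cosetProj H))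
    {m : Submodule ℝ (GroupLieAlgebra 𝓘(ℝ, E) G)}
    (hm : IsCompl (closedSubgroupLieAlgebra E H) m) (g : G) (v : TangentSpace 𝓘(ℝ, E) g) :
    (leftInvariantDistribution m g).projection (mfderiv 𝓘(ℝ, E) 𝓘(ℝ, F) (cosetProj H) g).ker
      (isCompl_leftInvariantDistribution hπ hm g) v = horizontalPart hm g v := by
  obtain ⟨A, rfl⟩ := exists_leftTranslate_eq g v
  rw [horizontalPart_leftTranslate]
  have h1 : leftTranslate g (m.projection _ hm.symm A) ∈ leftInvariantDistribution m g :=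
    ⟨_, Submodule.projection_apply_mem _ _, rfl⟩
  have h2 : leftTranslate g (A - m.projection _ hm.symm A) ∈
      (mfderiv 𝓘(ℝ, E) 𝓘(ℝ, F) (cosetProj H) g).ker :=
    (mfderiv_cosetProj_leftTranslate_eq_zero_iff hπ g _).2 (Submodule.sub_projection_mem _ _)
  have h3 : leftTranslate g A = leftTranslate g (m.projection _ hm.symm A) +
      leftTranslate g (A - m.projection _ hm.symm A) := by
    rw [← map_add, add_sub_cancel]
  rw [h3, map_add, Submodule.projection_apply_of_mem_left _ h1,
    (Submodule.projection_apply_eq_zero_iff _).2 h2, add_zero]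

theorem horizontalLift_cosetProj_eq
    (hπ : Manifold.IsSubmersion 𝓘(ℝ, E) 𝓘(ℝ, F) ∞ (cosetProj H))
    {m : Submodule ℝ (GroupLieAlgebra 𝓘(ℝ, E) G)}
    (hm : IsCompl (closedSubgroupLieAlgebra E H) m) {ι : F →L[ℝ] E}
    (hι : ∀ w, (cosetProjDeriv E F H (ι w) : F) = w) (hιm : ∀ w, ι w ∈ m)
    {X : VecField F (G ⧸ H)} {g : G} {w : F}
    (hw : cosetTranslate F H g w = X (cosetProj H g)) :
    horizontalLift (cosetProj H) (leftInvariantDistribution m) X g = leftTranslate g (ι w) := by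
  refine horizontalLift_eq (isCompl_leftInvariantDistribution hπ hm g) (hπ.mfderiv_surjective g)
    ⟨ι w, hιm w, rfl⟩ ?_
  refine (mfderiv_cosetProj_leftTranslate hπ g (ι w)).trans ?_
  exact (congrArg (cosetTranslate F H g) (hι w)).trans hw

/-- A linear map on the finite-dimensional space `F` depends linearly and continuously on its values
on a basis. -/
theorem contMDiffAt_clm_of_apply {M : Type*} [TopologicalSpace M] [ChartedSpace E M]
    {F' : Type*} [NormedAddCommGroup F'] [NormedSpace ℝ F'] {N : M → F →L[ℝ] F'} {x : M}
    (h : ∀ w, ContMDiffAt 𝓘(ℝ, E) 𝓘(ℝ, F') ∞ (fun y ↦ N y w) x) :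
    ContMDiffAt 𝓘(ℝ, E) 𝓘(ℝ, F →L[ℝ] F') ∞ N x := by
  let b := Module.finBasis ℝ F
  let coord : (i : _) → F →L[ℝ] ℝ := fun i ↦ LinearMap.toContinuousLinearMap (b.coord i)
  let K : (Fin (Module.finrank ℝ F) → F') →L[ℝ] (F →L[ℝ] F') :=
    ∑ i, (ContinuousLinearMap.smulRightL ℝ F F' (coord i)).comp (ContinuousLinearMap.proj i)
  have hN : N = fun y ↦ K (fun i ↦ N y (b i)) := by
    funext y
    ext w
    conv_lhs => rw [← b.sum_repr w, map_sum]
    simp only [map_smul]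
    simp [K, coord]
  rw [hN]
  exact K.contDiff.contMDiff.contMDiffAt.comp x (contMDiffAt_pi_space.2 fun i ↦ h (b i))

/-- The vector fields on `G/H` are given by functions on `G` with values in the tangent space at
the origin. -/
theorem exists_smooth_coefficient
    (hπ : Manifold.IsSubmersion 𝓘(ℝ, E) 𝓘(ℝ, F) ∞ (cosetProj H)) {ι : F →L[ℝ] E}
    (hι : ∀ w, (cosetProjDeriv E F H (ι w) : F) = w)
    {Y : VecField F (G ⧸ H)} (hY : Y.Smooth) :
    ∃ b : G → F, ContMDiff 𝓘(ℝ, E) 𝓘(ℝ, F) ∞ b ∧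
      ∀ g, (cosetTranslate F H g (b g) : F) = Y (cosetProj H g) := by
  let T : G → (F ≃L[ℝ] F) := fun g ↦ smulQuotientEquiv hπ g (cosetProj H 1)
  have hT : ∀ g (w : F), (cosetTranslate F H g w : F) = T g w := fun _ _ ↦ rfl
  let b : G → F := fun g ↦ (T g).symm (Y (cosetProj H g))
  have hb : ∀ g, (cosetTranslate F H g (b g) : F) = Y (cosetProj H g) := fun g ↦
    (T g).apply_symm_apply _
  refine ⟨b, fun g₀ ↦ ?_, hb⟩
  let e := trivializationAt F (TangentSpace 𝓘(ℝ, F)) (cosetProj H g₀)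
  -- `N g` is the differential of `τ_g` at the origin in a local trivialization. It is smooth in
  -- `g`, since its value at `w` is the coordinate of `π_*` of the left-invariant field of `ι w`;
  -- inversion of linear isomorphisms is smooth, and `b = N⁻¹ y`.
  let N : G → F →L[ℝ] F := fun g ↦
    (e.continuousLinearMapAt ℝ (cosetProj H g) : F →L[ℝ] F).comp (T g).toContinuousLinearMap
  let y : G → F := fun g ↦ (e ⟨cosetProj H g, Y (cosetProj H g)⟩).2
  have hbase : ∀ᶠ g in 𝓝 g₀, cosetProj H g ∈ e.baseSet :=
    hπ.contMDiff.continuous.continuousAt.eventually_mem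
      (e.open_baseSet.mem_nhds (FiberBundle.mem_baseSet_trivializationAt' _))
  have hy : ContMDiffAt 𝓘(ℝ, E) 𝓘(ℝ, F) ∞ y g₀ :=
    (Bundle.contMDiffAt_totalSpace.1 ((ContMDiff.comp hY hπ.contMDiff) g₀)).2
  have hNw : ∀ w, ContMDiffAt 𝓘(ℝ, E) 𝓘(ℝ, F) ∞ (fun g ↦ N g w) g₀ := by
    intro w
    have h1 : ContMDiff 𝓘(ℝ, E) 𝓘(ℝ, F).tangent ∞ _ :=
      (hπ.contMDiff.contMDiff_tangentMap (m := ∞) le_rfl).comp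
        (smooth_mulInvariantVectorField (G := G) (ι w))
    refine (Bundle.contMDiffAt_totalSpace.1 (h1 g₀)).2.congr_of_eventuallyEq ?_
    filter_upwards [hbase] with g hg
    have h2 : (mfderiv 𝓘(ℝ, E) 𝓘(ℝ, F) (cosetProj H) g (leftTranslate g (ι w)) : F) = T g w :=
      (mfderiv_cosetProj_leftTranslate hπ g (ι w)).trans
        (congrArg (cosetTranslate F H g) (hι w))
    refine (Bundle.Trivialization.continuousLinearMapAt_apply_of_mem ℝ e hg _).trans ?_
    exact congrArg (fun v : F ↦ (e ⟨cosetProj H g, v⟩).2) h2.symm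
  have hN : ContMDiffAt 𝓘(ℝ, E) 𝓘(ℝ, F →L[ℝ] F) ∞ N g₀ := contMDiffAt_clm_of_apply hNw
  have hNe : ∀ g, cosetProj H g ∈ e.baseSet → ∃ R : F ≃L[ℝ] F, N g = R.toContinuousLinearMap := by
    intro g hg
    refine ⟨(T g).trans (e.continuousLinearEquivAt ℝ (cosetProj H g) hg : F ≃L[ℝ] F), ?_⟩
    ext w
    refine (Bundle.Trivialization.continuousLinearMapAt_apply_of_mem ℝ e hg _).trans ?_
    rfl
  have hNb : ∀ᶠ g in 𝓝 g₀, b g = (N g).inverse (y g) := by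
    filter_upwards [hbase] with g hg
    obtain ⟨R, hR⟩ := hNe g hg
    have h1 : N g (b g) = y g := by
      refine (Bundle.Trivialization.continuousLinearMapAt_apply_of_mem ℝ e hg _).trans ?_
      exact congrArg (fun v : F ↦ (e ⟨cosetProj H g, v⟩).2) (hb g)
    rw [← h1, hR, ContinuousLinearMap.inverse_equiv]
    exact (R.symm_apply_apply _).symm
  obtain ⟨R, hR⟩ := hNe g₀ (FiberBundle.mem_baseSet_trivializationAt' _)
  have hinv : ContMDiffAt 𝓘(ℝ, E) 𝓘(ℝ, F →L[ℝ] F) ∞ (fun g ↦ (N g).inverse) g₀ :=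
    ContMDiffAt.comp g₀ (by rw [hR]; exact (contDiffAt_map_inverse R).contMDiffAt) hN
  exact (hinv.clm_apply hy).congr_of_eventuallyEq hNb

end HorizontalLift

/-! ### The Leibniz rule for combinations of vector fields. -/

section Connection

variable {E : Type*} [NormedAddCommGroup E] [NormedSpace ℝ E]
  {M : Type*} [TopologicalSpace M] [ChartedSpace E M] [IsManifold 𝓘(ℝ, E) ∞ M]

theorem AffineConnection.sum_smul_apply (nabla : AffineConnection E M) {κ : Type*} (s : Finset κ)
    {f : κ → M → ℝ} {V : κ → VecField E M} {x : M} {D : κ → E →L[ℝ] ℝ}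
    (hf : ∀ i, HasMFDerivAt 𝓘(ℝ, E) 𝓘(ℝ, ℝ) (f i) x (D i)) (hV : ∀ i, (V i).DiffAt x) (v : E) :
    (nabla (∑ i ∈ s, f i • V i) x v : E) =
      ∑ i ∈ s, (f i x • (nabla (V i) x v : E) + D i v • (V i x : E)) := by
  classical
  have hsmul : ∀ i, VecField.DiffAt (f i • V i) x := fun i ↦
    (hf i).mdifferentiableAt.smul_section (hV i)
  induction s using Finset.induction_on with
  | empty =>
    rw [Finset.sum_empty, Finset.sum_empty, CovariantDerivative.zero]
    rfl
  | insert i s hi ih =>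
    have hs : VecField.DiffAt (∑ j ∈ s, f j • V j) x := by
      have := MDifferentiableAt.sum_section (s := s) (fun j _ ↦ hsmul j)
      simpa only [VecField.DiffAt, Finset.sum_apply] using this
    rw [Finset.sum_insert hi, Finset.sum_insert hi,
      nabla.isCovariantDerivativeOnUniv.add (hsmul i) hs]
    refine congrArg₂ (fun a b : E ↦ a + b) ?_ ih
    rw [nabla.isCovariantDerivativeOnUniv.leibniz (hV i) (hf i).mdifferentiableAt]
    have h1 : mvfderiv 𝓘(ℝ, E) (f i) x = D i := by
      rw [mvfderiv, (hf i).mfderiv]; rfl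
    rw [h1]
    rfl

end Connection

/-! ### Invariant connections and translated frames. -/

section ReductiveHomogeneousSpace

variable {E : Type*} [NormedAddCommGroup E] [NormedSpace ℝ E] [FiniteDimensional ℝ E]
  {G : Type*} [TopologicalSpace G] [ChartedSpace E G] [Group G]
  [LieGroup 𝓘(ℝ, E) ∞ G]
  {F : Type*} [NormedAddCommGroup F] [NormedSpace ℝ F] [FiniteDimensional ℝ F] {H : Subgroup G}
  [ChartedSpace F (G ⧸ H)] [IsManifold 𝓘(ℝ, F) ∞ (G ⧸ H)]

/-- A left-invariant field is its own pullback under `L_g`, so invariance carries the formula from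
`1` to `g`. -/
theorem IsLeftInvariantConnectionOf.apply_leftTranslate
    {alpha : GroupLieAlgebra 𝓘(ℝ, E) G →ₗ[ℝ]
      GroupLieAlgebra 𝓘(ℝ, E) G →ₗ[ℝ] GroupLieAlgebra 𝓘(ℝ, E) G}
    {nabla : AffineConnection E G} (h : IsLeftInvariantConnectionOf alpha nabla) (g : G)
    (A B : GroupLieAlgebra 𝓘(ℝ, E) G) :
    nabla (mulInvariantVectorField B) g (leftTranslate g A) = leftTranslate g (alpha A B) := by
  have : LieGroup 𝓘(ℝ, E) (minSmoothness ℝ 3) G := .of_le (n := ∞) (by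
    rw [minSmoothness_of_isRCLikeNormedField]
    exact WithTop.coe_le_coe.2 (show (3 : ℕ∞) ≤ ⊤ from le_top))
  have h1 := h.invariant g _ (smooth_mulInvariantVectorField B) 1 A
  rw [mpullback_mulInvariantVectorField] at h1
  have h2 : (nabla (mulInvariantVectorField B) 1 A : E) = alpha A B := by
    have h3 := h.deriv_one A B
    have h4 : (mulInvariantVectorField A (1 : G) : E) = A := leftTranslate_one (G := G) A
    exact (congrArg (fun v : E ↦ (nabla (mulInvariantVectorField B) (1 : G) v : E)) h4).symm.trans
      h3
  have h5 : ∀ x : G, x = g → (nabla (mulInvariantVectorField B) x (leftTranslate g A : E) : E) =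
      nabla (mulInvariantVectorField B) g (leftTranslate g A) := by
    rintro x rfl; rfl
  refine (h5 (g * 1) (mul_one g)).symm.trans (h1.symm.trans ?_)
  exact congrArg (leftTranslate g : E →L[ℝ] E) h2

/-- The translates of a tangent vector at the origin along a section of `π`, as a vector field. -/
def translatedField (σ : G ⧸ H → G) (w : F) : VecField F (G ⧸ H) :=
  fun q ↦ (cosetTranslate F H (σ q) w : F)

/-- The field is `σ` followed by the smooth map `x ↦ π_*` of the left-invariant field of `ι w` at
`x`, so it is differentiable wherever `σ` is. -/
theorem diffAt_translatedField
    (hπ : Manifold.IsSubmersion 𝓘(ℝ, E) 𝓘(ℝ, F) ∞ (cosetProj H)) {ι : F →L[ℝ] E}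
    (hι : ∀ w, (cosetProjDeriv E F H (ι w) : F) = w) {σ : G ⧸ H → G}
    (hσ : ∀ q, cosetProj H (σ q) = q) {q : G ⧸ H}
    (hσd : MDifferentiableAt 𝓘(ℝ, F) 𝓘(ℝ, E) σ q) (w : F) :
    (translatedField σ w).DiffAt q := by
  have h1 : ContMDiff 𝓘(ℝ, E) 𝓘(ℝ, F).tangent ∞ _ :=
    (hπ.contMDiff.contMDiff_tangentMap (m := ∞) le_rfl).comp
      (smooth_mulInvariantVectorField (G := G) (ι w))
  have h2 := (h1.mdifferentiable (by simp) (σ q)).comp q hσd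
  refine h2.congr_of_eventuallyEq (.of_forall fun q' ↦ ?_)
  refine (TangentBundle.mk_congr (E := F) (hσ q') (translatedField σ w q')).symm.trans ?_
  refine congrArg (fun v : F ↦ (⟨cosetProj H (σ q'), v⟩ : TangentBundle 𝓘(ℝ, F) (G ⧸ H))) ?_
  exact ((mfderiv_cosetProj_leftTranslate hπ (σ q') (ι w)).trans
    (congrArg (cosetTranslate F H (σ q')) (hι w))).symm

theorem isLocallyStar_translatedField
    {m : Submodule ℝ (GroupLieAlgebra 𝓘(ℝ, E) G)} {σ : G ⧸ H → G}
    (hσ : ∀ᶠ u : m in 𝓝 0, σ (cosetProj H (lieExp (u : GroupLieAlgebra 𝓘(ℝ, E) G))) =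
        lieExp (u : GroupLieAlgebra 𝓘(ℝ, E) G)) (B : m) :
    IsLocallyStar m B (translatedField (F := F) σ (cosetProjDeriv E F H B : F)) := by
  filter_upwards [hσ] with u hu
  have h : ∀ x y : G, x = y → ∀ w : F, (cosetTranslate F H x w : F) = cosetTranslate F H y w := by
    rintro x _ rfl w; rfl
  exact h _ _ hu _

/-- Invariance expresses the covariant derivative of `Y` at `π g` by the one at the origin of the
pullback of `Y` by the translation by `g`. -/
theorem AffineConnection.PreservedBy.apply_cosetTranslate {nabla : AffineConnection F (G ⧸ H)}
    {g : G} (h : nabla.PreservedBy (fun q : G ⧸ H ↦ g • q)) {Y : VecField F (G ⧸ H)}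
    (hY : Y.Smooth) (w : F) :
    (nabla Y (cosetProj H g) (cosetTranslate F H g w) : F) =
      cosetTranslate F H g (nabla (VectorField.mpullback 𝓘(ℝ, F) 𝓘(ℝ, F)
        (fun q : G ⧸ H ↦ g • q) Y) (cosetProj H 1) w) := by
  have h1 := h Y hY (cosetProj H 1) w
  have h2 : ∀ q q' : G ⧸ H, q = q' → ∀ v : F, (nabla Y q v : F) = nabla Y q' v := by
    rintro q _ rfl v; rfl
  have h3 : g • cosetProj H 1 = cosetProj H g := by simp [cosetProj]
  exact (h2 _ _ h3 _).symm.trans h1.symm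

/-- Since `g • q = π (g σ(q))`, the value of `Y` there is `(τ_g)_* (τ_{σ q})_* b(g σ(q))`, and the
pullback cancels `(τ_g)_*`. -/
theorem mpullback_smul_eq
    (hπ : Manifold.IsSubmersion 𝓘(ℝ, E) 𝓘(ℝ, F) ∞ (cosetProj H)) {Y : VecField F (G ⧸ H)}
    {b : G → F} (hb : ∀ g, (cosetTranslate F H g (b g) : F) = Y (cosetProj H g))
    {σ : G ⧸ H → G} (hσ : ∀ q, cosetProj H (σ q) = q) (g : G) (q : G ⧸ H) :
    (VectorField.mpullback 𝓘(ℝ, F) 𝓘(ℝ, F) (fun q : G ⧸ H ↦ g • q) Y q : F) =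
      cosetTranslate F H (σ q) (b (g * σ q)) := by
  have h1 : ∀ q q' : G ⧸ H, q = q' → (Y q : F) = Y q' := by rintro q _ rfl; rfl
  have h2 : ∀ q q' : G ⧸ H, q = q' → ∀ v : F,
      (mfderiv 𝓘(ℝ, F) 𝓘(ℝ, F) (fun q : G ⧸ H ↦ g • q) q : F →L[ℝ] F) v =
        (mfderiv 𝓘(ℝ, F) 𝓘(ℝ, F) (fun q : G ⧸ H ↦ g • q) q' : F →L[ℝ] F) v := by
    rintro q _ rfl v; rfl
  have h3 : cosetProj H (g * σ q) = g • q := by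
    conv_rhs => rw [← hσ q]
    simp [cosetProj]
  have h4 : (mfderiv 𝓘(ℝ, F) 𝓘(ℝ, F) (fun q : G ⧸ H ↦ g • q) q : F →L[ℝ] F)
      (cosetTranslate F H (σ q) (b (g * σ q))) = Y (g • q) :=
    (h2 _ _ (hσ q) _).symm.trans ((mfderiv_smul_quotient_cosetTranslate hπ g (σ q) _).trans
      ((hb (g * σ q)).trans (h1 _ _ h3)))
  change (mfderiv 𝓘(ℝ, F) 𝓘(ℝ, F) (fun q : G ⧸ H ↦ g • q) q : F →L[ℝ] F).inverse (Y (g • q)) = _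
  rw [← h4]
  exact inverse_mfderiv_smul_quotient_apply hπ g q _

end ReductiveHomogeneousSpace

/-! ### Comparison of the two covariant derivatives. -/

section AffineSubmersion

variable {E : Type*} [NormedAddCommGroup E] [NormedSpace ℝ E] [FiniteDimensional ℝ E]
  {G : Type*} [TopologicalSpace G] [T2Space G] [ChartedSpace E G] [Group G]
  [LieGroup 𝓘(ℝ, E) ∞ G]
  {F : Type*} [NormedAddCommGroup F] [NormedSpace ℝ F] [FiniteDimensional ℝ F] {H : Subgroup G}
  [ChartedSpace F (G ⧸ H)] [IsManifold 𝓘(ℝ, F) ∞ (G ⧸ H)]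

theorem horizontalPart_deriv_horizontalLift
    (hπ : Manifold.IsSubmersion 𝓘(ℝ, E) 𝓘(ℝ, F) ∞ (cosetProj H))
    {m : Submodule ℝ (GroupLieAlgebra 𝓘(ℝ, E) G)}
    (hm : IsCompl (closedSubgroupLieAlgebra E H) m)
    {nablaGH : AffineConnection F (G ⧸ H)}
    (hinv : ∀ a : G, nablaGH.PreservedBy (fun q : G ⧸ H ↦ a • q))
    {beta : m →ₗ[ℝ] m →ₗ[ℝ] m} (hbeta : IsBilinearFormOf m beta nablaGH)
    {alpha : GroupLieAlgebra 𝓘(ℝ, E) G →ₗ[ℝ]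
      GroupLieAlgebra 𝓘(ℝ, E) G →ₗ[ℝ] GroupLieAlgebra 𝓘(ℝ, E) G}
    (halpha : ∀ A B : m, m.projection (closedSubgroupLieAlgebra E H) hm.symm
      (alpha A B) = beta A B)
    {nablaG : AffineConnection E G} (hG : IsLeftInvariantConnectionOf alpha nablaG)
    (X : VecField F (G ⧸ H)) {Y : VecField F (G ⧸ H)} (hY : Y.Smooth) (g : G) :
    horizontalPart hm g
        (nablaG.deriv (horizontalLift (cosetProj H) (leftInvariantDistribution m) X)
          (horizontalLift (cosetProj H) (leftInvariantDistribution m) Y) g) =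
      horizontalLift (cosetProj H) (leftInvariantDistribution m) (nablaGH.deriv X Y) g := by
  obtain ⟨ι, hι, hιm, hmι⟩ := exists_lift_cosetProjDeriv hπ hm
  obtain ⟨b, hb, hbY⟩ := exists_smooth_coefficient hπ hι hY
  obtain ⟨σ, hσ, hσ1, hσd, hσexp⟩ := exists_exponential_section hπ hι hmι
  let v := Module.finBasis ℝ F
  let coord : Fin (Module.finrank ℝ F) → F →L[ℝ] ℝ :=
    fun i ↦ LinearMap.toContinuousLinearMap (v.coord i)
  have hcoord : ∀ w : F, ∑ i, coord i w • v i = w := fun w ↦ v.sum_repr w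
  let L : E →L[ℝ] E := leftTranslate g
  let T : G → F →L[ℝ] F := fun x ↦ cosetTranslate F H x
  let db : E →L[ℝ] F := mfderiv 𝓘(ℝ, E) 𝓘(ℝ, F) b g
  have hdb : HasMFDerivAt 𝓘(ℝ, E) 𝓘(ℝ, F) b g db :=
    (hb.mdifferentiable (by simp) g).hasMFDerivAt
  let a : F := (smulQuotientEquiv hπ g (cosetProj H 1)).symm (X (cosetProj H g))
  have ha : T g a = X (cosetProj H g) :=
    (smulQuotientEquiv hπ g (cosetProj H 1)).apply_symm_apply _
  let al : E → E → E := fun A B ↦ alpha A B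
  let ιm : F → m := fun w ↦ ⟨ι w, hιm w⟩
  let B : Fin (Module.finrank ℝ F) → F := fun i ↦ cosetProjDeriv E F H (beta (ιm a) (ιm (v i)))
  have hB : ∀ i, ι (B i) = (beta (ιm a) (ιm (v i))).1 := fun i ↦ hmι _ (beta _ _).2
  -- Both sides will equal `(L_g)_* (ι c)`: the first summand collects the `β` terms, the second the
  -- derivatives of the coefficients of `Y`.
  let c : F := ∑ i, (coord i (b g) • B i + coord i (db (L (ι a))) • v i)
  -- the left-hand side
  have hX : horizontalLift (cosetProj H) (leftInvariantDistribution m) X g = L (ι a) :=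
    horizontalLift_cosetProj_eq hπ hm hι hιm ha
  have hYL : horizontalLift (cosetProj H) (leftInvariantDistribution m) Y =
      ∑ i, (fun x ↦ coord i (b x)) • (mulInvariantVectorField (ι (v i)) : VecField E G) := by
    funext x
    rw [horizontalLift_cosetProj_eq hπ hm hι hιm (hbY x), Finset.sum_apply]
    let Λ : F →L[ℝ] E := (leftTranslate x : E →L[ℝ] E).comp ι
    change Λ (b x) = ∑ i, coord i (b x) • Λ (v i)
    conv_lhs => rw [← hcoord (b x), map_sum]
    simp only [map_smul]
  have hfd : ∀ i, HasMFDerivAt 𝓘(ℝ, E) 𝓘(ℝ, ℝ) (fun x ↦ coord i (b x)) g ((coord i).comp db) :=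
    fun i ↦ (coord i).hasFDerivAt.hasMFDerivAt.comp g hdb
  have hleft : (nablaG.deriv (horizontalLift (cosetProj H) (leftInvariantDistribution m) X)
      (horizontalLift (cosetProj H) (leftInvariantDistribution m) Y) g : E) =
      L (∑ i, (coord i (b g) • al (ι a) (ι (v i)) +
        coord i (db (L (ι a))) • ι (v i))) := by
    rw [AffineConnection.deriv, hYL, hX]
    refine (nablaG.sum_smul_apply Finset.univ hfd
      (fun i ↦ (smooth_mulInvariantVectorField _).mdifferentiable (by simp) g) _).trans ?_
    rw [map_sum]
    refine Finset.sum_congr rfl fun i _ ↦ ?_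
    rw [map_add, map_smul, map_smul]
    exact congrArg (fun u : E ↦ coord i (b g) • u + coord i (db (L (ι a))) • L (ι (v i)))
      (hG.apply_leftTranslate g (ι a) (ι (v i)))
  let pr : E →ₗ[ℝ] E := m.projection (closedSubgroupLieAlgebra E H) hm.symm
  -- The projection sends `α` to `β` on `m` and fixes the vectors `ι (v i)`, which lie in `m`.
  have hproj : pr (∑ i, (coord i (b g) • al (ι a) (ι (v i)) +
      coord i (db (L (ι a))) • ι (v i))) = ι c := by
    rw [map_sum, map_sum]
    refine Finset.sum_congr rfl fun i _ ↦ ?_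
    rw [map_add, map_add, map_smul, map_smul, map_smul, map_smul, hB]
    exact congrArg₂ (fun u w : E ↦ coord i (b g) • u + coord i (db (L (ι a))) • w)
      (halpha (ιm a) (ιm (v i))) (Submodule.projection_apply_of_mem_left hm.symm (hιm (v i)))
  -- the right-hand side
  have hpull : VectorField.mpullback 𝓘(ℝ, F) 𝓘(ℝ, F) (fun q : G ⧸ H ↦ g • q) Y =
      ∑ i, (fun q ↦ coord i (b (g * σ q))) • translatedField (F := F) σ (v i) := by
    funext q
    rw [Finset.sum_apply]
    refine (mpullback_smul_eq hπ hbY hσ g q).trans ?_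
    change T (σ q) (b (g * σ q)) = ∑ i, coord i (b (g * σ q)) • T (σ q) (v i)
    conv_lhs => rw [← hcoord (b (g * σ q)), map_sum]
    simp only [map_smul]
  -- This is why the coefficient derivatives agree: `q ↦ g σ(q)` maps the vector `a` at the origin
  -- to `(L_g)_* (ι a)`, the value at `g` of the horizontal lift of `X`.
  have hσg : HasMFDerivAt 𝓘(ℝ, F) 𝓘(ℝ, E) (fun q ↦ g * σ q) (cosetProj H 1) (L.comp ι) := by
    have h1 : HasMFDerivAt 𝓘(ℝ, E) 𝓘(ℝ, E) (fun x : G ↦ g * x) (σ (cosetProj H 1)) L := by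
      rw [hσ1]
      exact (mdifferentiableAt_mul_left' g 1).hasMFDerivAt
    exact h1.comp _ hσd
  have hfd' : ∀ i, HasMFDerivAt 𝓘(ℝ, F) 𝓘(ℝ, ℝ) (fun q ↦ coord i (b (g * σ q))) (cosetProj H 1)
      (((coord i).comp db).comp (L.comp ι)) := by
    intro i
    have h1 : HasMFDerivAt 𝓘(ℝ, E) 𝓘(ℝ, ℝ) (fun x ↦ coord i (b x)) (g * σ (cosetProj H 1))
        ((coord i).comp db) := by
      rw [hσ1, mul_one]
      exact hfd i
    exact HasMFDerivAt.comp (g := fun x ↦ coord i (b x)) (f := fun q ↦ g * σ q) _ h1 hσg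
  have hdiff : ∀ i, (translatedField (F := F) σ (v i)).DiffAt (cosetProj H 1) := fun i ↦
    diffAt_translatedField hπ hι hσ hσd.mdifferentiableAt (v i)
  -- Here the exponential form of `σ` enters: the translated field coincides near `o` with the field
  -- `B_*` for `B = ι (v i)`, so `β` gives its derivative.
  have hstar : ∀ i, (nablaGH (translatedField (F := F) σ (v i)) (cosetProj H 1) a : F) = B i := by
    intro i
    have h1 : (cosetProjDeriv E F H (ιm (v i)) : F) = v i := hι (v i)
    have h2 := isLocallyStar_translatedField (F := F) hσexp (ιm (v i))
    rw [h1] at h2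
    have h3 := hbeta (ιm a) (ιm (v i)) _ (hdiff i) h2
    exact (congrArg (nablaGH (translatedField (F := F) σ (v i)) (cosetProj H 1) : F →L[ℝ] F)
      (hι a)).symm.trans h3
  have htr : ∀ i, (translatedField (F := F) σ (v i) (cosetProj H 1) : F) = v i := by
    intro i
    have h1 : ∀ x : G, x = 1 → T x (v i) = v i := by
      rintro x rfl; exact cosetTranslate_one (F := F) (H := H) (v i)
    exact h1 _ hσ1
  have horigin : (nablaGH (VectorField.mpullback 𝓘(ℝ, F) 𝓘(ℝ, F) (fun q : G ⧸ H ↦ g • q) Y)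
      (cosetProj H 1) a : F) = c := by
    rw [hpull]
    refine (nablaGH.sum_smul_apply Finset.univ hfd' hdiff a).trans ?_
    refine Finset.sum_congr rfl fun i _ ↦ ?_
    rw [hstar, htr, hσ1, mul_one]
    rfl
  have hright : T g c = nablaGH.deriv X Y (cosetProj H g) := by
    rw [AffineConnection.deriv, ← ha]
    exact ((hinv g).apply_cosetTranslate hY a).trans (congrArg (T g) horigin) |>.symm
  rw [horizontalLift_cosetProj_eq hπ hm hι hιm hright, hleft]
  refine (horizontalPart_leftTranslate hm g _).trans ?_
  exact congrArg L hproj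

end AffineSubmersion

end

theorem proposition2p1
    {E : Type*} [NormedAddCommGroup E] [NormedSpace ℝ E] [FiniteDimensional ℝ E]
    {G : Type*} [TopologicalSpace G] [T2Space G] [ChartedSpace E G] [Group G]
    [LieGroup 𝓘(ℝ, E) ∞ G]
    -- a closed subgroup `H`, and the smooth structure on `G/H` that makes `π` a submersion
    (H : Subgroup G) (hH : IsClosed (H : Set G))
    {F : Type*} [NormedAddCommGroup F] [NormedSpace ℝ F] [FiniteDimensional ℝ F]
    [ChartedSpace F (G ⧸ H)] [IsManifold 𝓘(ℝ, F) ∞ (G ⧸ H)]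
    (hπ : Manifold.IsSubmersion 𝓘(ℝ, E) 𝓘(ℝ, F) ∞ (cosetProj H))
    -- a reductive decomposition
    (m : Submodule ℝ (GroupLieAlgebra 𝓘(ℝ, E) G)) (hm : IsReductiveComplement H m)
    -- a `G`-invariant connection on `G/H` and its bilinear map `β`
    (nablaGH : AffineConnection F (G ⧸ H))
    (hinv : ∀ a : G, nablaGH.PreservedBy (fun q : G ⧸ H ↦ a • q))
    (beta : m →ₗ[ℝ] m →ₗ[ℝ] m) (hbeta : IsBilinearFormOf m beta nablaGH)
    -- an extension `α` of `β` and the left-invariant connection on `G` that it defines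
    (alpha : GroupLieAlgebra 𝓘(ℝ, E) G →ₗ[ℝ]
      GroupLieAlgebra 𝓘(ℝ, E) G →ₗ[ℝ] GroupLieAlgebra 𝓘(ℝ, E) G)
    (halpha : ∀ A B : m, m.projection (closedSubgroupLieAlgebra E H) hm.isCompl.symm
      (alpha A B) = beta A B)
    (nablaG : AffineConnection E G) (hG : IsLeftInvariantConnectionOf alpha nablaG) :
    (∀ X Y : VecField F (G ⧸ H), X.Smooth → Y.Smooth → ∀ g : G,
      horizontalPart hm.isCompl g
          (nablaG.deriv (horizontalLift (cosetProj H) (leftInvariantDistribution m) X)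
            (horizontalLift (cosetProj H) (leftInvariantDistribution m) Y) g) =
        horizontalLift (cosetProj H) (leftInvariantDistribution m) (nablaGH.deriv X Y) g) ∧
    IsAffineSubmersionWithHorizontalDistribution (cosetProj H) (leftInvariantDistribution m)
      nablaG nablaGH := by
  have key := fun (X Y : VecField F (G ⧸ H)) (hY : Y.Smooth) (g : G) ↦
    horizontalPart_deriv_horizontalLift hπ hm.isCompl hinv hbeta halpha hG X hY g
  exact ⟨fun X Y _ hY g ↦ key X Y hY g, hπ, isSmoothDistribution_leftInvariantDistribution m,
    isCompl_leftInvariantDistribution hπ hm.isCompl, fun X Y _ hY g ↦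
      (projection_ker_eq_horizontalPart hπ hm.isCompl g _).trans (key X Y hY g)⟩
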